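/- For $a\in\mathbb R$ let $\omega^a(x)=x^a$ on $\mathbb R^+=(0,\infty)$, and let $L^2_{\omega^a}(\mathbb R^+)$ be the space of complex-valued functions with $\|f\|_{\omega^a}^2=\int_0^\infty |f(x)|^2x^a\,dx<\infty$ and inner product $(f,g)_{\omega^a}=\int_0^\infty f\,\bar g\,x^a\,dx$. For $\lambda>0$ and $s\in[k-1,k)$ with $k\in\{1,2,\dots\}$, the right tempered fractional derivative is $${}_xD^{s,\lambda}_\infty u(x)=e^{\lambda x}\,(-1)^k\frac{d^k}{dx^k}\left(\frac{1}{\Gamma(k-s)}\int_x^\infty (y-x)^{k-s-1}e^{-\lambda y}u(y)\,dy\right),\qquad x>0,$$ where $d^k/dx^k$ is the weak (distributional) derivative on $\mathbb R^+$ and the result is required to be locally integrable on $\mathbb R^+$. For $\nu,r>0$ let $$B^r_{\nu,\lambda}(\mathbb R^+)=\{u\in L^2_{\omega^\nu}(\mathbb R^+):\ {}_xD^{s,\lambda}_\infty u \text{ exists and belongs to } L^2_{\omega^{\nu+s}}(\mathbb R^+)\text{ for all real } 0\le s\le r\}.$$ For $N\in\mathbb N$ let $\mathcal P_N$ be the set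 of polynomials (with complex coefficients) of degree at most $N$, and let $\Pi^{\nu,\lambda}_N$ be the orthogonal projection of $L^2_{\omega^\nu}(\mathbb R^+)$ onto $\{e^{-\lambda x}p(x):p\in\mathcal P_N\}$, i.e. $(\Pi^{\nu,\lambda}_Nu-u,\phi)_{\omega^\nu}=0$ for all $\phi$ in that space. **Theorem.** Let $\nu,r>0$. There is a sequence of constants $c=c_N$, depending only on $\nu$, $r$ and $N$, with $c_N\to1$ as $N\to\infty$, such that for all $\lambda>0$, all real $s$ and integers $N$ with $0\le s\le r\le N$, and all $u\in B^r_{\nu,\lambda}(\mathbb R^+)$, the derivative ${}_xD^{s,\lambda}_\infty(\Pi^{\nu,\lambda}_Nu-u)$ exists and belongs to $L^2_{\omega^{\nu+s}}(\mathbb R^+)$, and $$\big\|{}_xD^{s,\lambda}_\infty\{\Pi^{\nu,\lambda}_Nu-u\}\big\|_{\omega^{\nu+s}}\le c_N\,(2\lambda N)^{\frac{s-r}{2}}\,\big\|{}_xD^{r,\lambda}_\infty u\big\|_{\omega^{\nu+r}}.$$ -/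

import Mathlib

open MeasureTheory Set Filter Topology

noncomputable section

/-- The measure `x ^ a dx` on `ℝ⁺ = (0, ∞)`.  The weighted space `L²_{ω^a}(ℝ⁺)`, `ω^a(x) = x ^ a`,
is `L²` of this measure, with inner product `∫_{ℝ⁺} f \bar g x ^ a dx`. -/
def weightMeasure (a : ℝ) : Measure ℝ :=
  (volume.restrict (Ioi (0 : ℝ))).withDensity (fun x => ENNReal.ofReal (x ^ a))

/-- The norm `‖f‖_{ω^a} = (∫_{ℝ⁺} |f(x)|² x ^ a dx)^{1/2}`, for `f ∈ L²_{ω^a}(ℝ⁺)`. -/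
def weightNorm (a : ℝ) (f : ℝ → ℂ) : ℝ :=
  (eLpNorm f 2 (weightMeasure a)).toReal

/-- The integrand of the right Riemann–Liouville integral, `(y - x) ^ (μ - 1) f(y)`. -/
def rightRLKernel (μ : ℝ) (f : ℝ → ℂ) (x y : ℝ) : ℂ :=
  (((y - x) ^ (μ - 1) : ℝ) : ℂ) * f y

/-- The right Riemann–Liouville fractional integral of order `μ`,
`(1 / Γ(μ)) ∫_x^∞ (y - x) ^ (μ - 1) f(y) dy`. -/
def rightRLIntegral (μ : ℝ) (f : ℝ → ℂ) (x : ℝ) : ℂ :=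
  ((1 / Real.Gamma μ : ℝ) : ℂ) * ∫ y in Ioi x, rightRLKernel μ f x y

/-- `g` is the right Riemann–Liouville derivative of `f` of order `s ≥ 0` on `ℝ⁺`: with
`k = ⌊s⌋ + 1` (so `s ∈ [k - 1, k)`), the integral of order `k - s` of `f` converges a.e. to a
locally integrable function, and `(-1) ^ k` times the `k`-th (weak) derivative of this function
is `g`.  The sign is absorbed by the `k` integrations by parts onto the test function. -/
def IsRightRLDeriv (s : ℝ) (f g : ℝ → ℂ) : Prop :=
  (∀ᵐ x ∂(volume.restrict (Ioi (0 : ℝ))),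
      IntegrableOn (rightRLKernel ((⌊s⌋₊ + 1 : ℕ) - s) f x) (Ioi x)) ∧
  LocallyIntegrableOn (rightRLIntegral ((⌊s⌋₊ + 1 : ℕ) - s) f) (Ioi (0 : ℝ)) ∧
  LocallyIntegrableOn g (Ioi (0 : ℝ)) ∧
  ∀ φ : ℝ → ℝ, ContDiff ℝ (⊤ : ℕ∞) φ → HasCompactSupport φ → tsupport φ ⊆ Ioi (0 : ℝ) →
    ∫ x in Ioi (0 : ℝ),
        ((iteratedDeriv (⌊s⌋₊ + 1) φ x : ℝ) : ℂ) * rightRLIntegral ((⌊s⌋₊ + 1 : ℕ) - s) f x =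
      ∫ x in Ioi (0 : ℝ), ((φ x : ℝ) : ℂ) * g x

open Classical in
/-- The right Riemann–Liouville derivative of order `s` as a function, determined a.e. on `ℝ⁺`
(and set to `0` when it does not exist). -/
def rightRLDeriv (s : ℝ) (f : ℝ → ℂ) : ℝ → ℂ :=
  if h : ∃ g, IsRightRLDeriv s f g then h.choose else 0

/-- The function `x ↦ e^{-λ x} u(x)`. -/
def temper (lam : ℝ) (u : ℝ → ℂ) (x : ℝ) : ℂ :=
  ((Real.exp (-(lam * x)) : ℝ) : ℂ) * u x

/-- The right tempered fractional derivative of order `s` of `u` exists on `ℝ⁺`. -/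
def HasRightTemperedDeriv (lam s : ℝ) (u : ℝ → ℂ) : Prop :=
  ∃ g, IsRightRLDeriv s (temper lam u) g

/-- The right tempered fractional derivative `e^{λ x} ₓD_∞^s {e^{-λ x} u}` of order `s`. -/
def rightTemperedDeriv (lam s : ℝ) (u : ℝ → ℂ) (x : ℝ) : ℂ :=
  ((Real.exp (lam * x) : ℝ) : ℂ) * rightRLDeriv s (temper lam u) x

/-- The tempered derivative of order `s` of `u` exists and belongs to `L²_{ω^a}(ℝ⁺)`. -/
def TemperedDerivMemL2 (lam s a : ℝ) (u : ℝ → ℂ) : Prop :=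
  HasRightTemperedDeriv lam s u ∧ MemLp (rightTemperedDeriv lam s u) 2 (weightMeasure a)

/-- The non-uniformly weighted space `B^r_{ν,λ}(ℝ⁺)`. -/
def spaceB (nu lam r : ℝ) : Set (Lp ℂ 2 (weightMeasure nu)) :=
  {u | ∀ s : ℝ, 0 ≤ s → s ≤ r → TemperedDerivMemL2 lam s (nu + s) u}

/-- The space `{e^{-λ x} p : p ∈ 𝒫_N}`, as a subspace of `L²_{ω^ν}(ℝ⁺)`. -/
def expPolySpace (nu lam : ℝ) (N : ℕ) : Submodule ℂ (Lp ℂ 2 (weightMeasure nu)) where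
  carrier := {f | ∃ p : Polynomial ℂ, p.degree ≤ N ∧
    f =ᵐ[weightMeasure nu] temper lam (fun x => p.eval (x : ℂ))}
  add_mem' := by
    rintro f g ⟨p, hp, hf⟩ ⟨q, hq, hg⟩
    refine ⟨p + q, (Polynomial.degree_add_le p q).trans (max_le hp hq), ?_⟩
    filter_upwards [Lp.coeFn_add f g, hf, hg] with x h1 h2 h3
    refine h1.trans ?_
    simp [h2, h3, temper, mul_add]
  zero_mem' := by
    refine ⟨0, by simp, ?_⟩
    filter_upwards [Lp.coeFn_zero ℂ 2 (weightMeasure nu)] with x h1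
    refine h1.trans ?_
    simp [temper]
  smul_mem' := by
    rintro c f ⟨p, hp, hf⟩
    refine ⟨c • p, (Polynomial.degree_smul_le c p).trans hp, ?_⟩
    filter_upwards [Lp.coeFn_smul c f, hf] with x h1 h2
    refine h1.trans ?_
    simp [h2, temper]
    ring

/-- The polynomials of degree at most `N` for which `e^{-λ x} p` is in `L²_{ω^ν}(ℝ⁺)`. -/
def expPolyDomain (nu lam : ℝ) (N : ℕ) : Submodule ℂ (Polynomial ℂ) where
  carrier := {p | p.degree ≤ N ∧
    MemLp (temper lam (fun x => p.eval (x : ℂ))) 2 (weightMeasure nu)}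
  add_mem' := by
    rintro p q ⟨hp, hp'⟩ ⟨hq, hq'⟩
    refine ⟨(Polynomial.degree_add_le p q).trans (max_le hp hq), ?_⟩
    convert hp'.add hq' using 1
    ext x
    simp [temper, mul_add]
  zero_mem' := by
    refine ⟨by simp, ?_⟩
    convert MemLp.zero (ε := ℂ) (p := 2) (μ := weightMeasure nu) using 1
    ext x
    simp [temper]
  smul_mem' := by
    rintro c p ⟨hp, hp'⟩
    refine ⟨(Polynomial.degree_smul_le c p).trans hp, ?_⟩
    convert hp'.const_smul c using 1
    ext x
    simp [temper]
    ring

/-- The linear map `p ↦ e^{-λ x} p`. -/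
def expPolyMap (nu lam : ℝ) (N : ℕ) :
    expPolyDomain nu lam N →ₗ[ℂ] Lp ℂ 2 (weightMeasure nu) where
  toFun p := p.2.2.toLp _
  map_add' p q := by
    rw [← MemLp.toLp_add]
    congr 1
    ext x
    simp [temper, mul_add]
  map_smul' c p := by
    rw [RingHom.id_apply, ← MemLp.toLp_const_smul]
    congr 1
    ext x
    simp [temper]
    ring

instance expPolySpace_finiteDimensional (nu lam : ℝ) (N : ℕ) :
    FiniteDimensional ℂ (expPolySpace nu lam N) := by
  have h1 : FiniteDimensional ℂ (Polynomial.degreeLT ℂ (N + 1)) :=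
    (Polynomial.degreeLTEquiv ℂ (N + 1)).symm.finiteDimensional
  have h2 : expPolyDomain nu lam N ≤ Polynomial.degreeLT ℂ (N + 1) := by
    intro p hp
    rw [Polynomial.mem_degreeLT]
    refine lt_of_le_of_lt hp.1 ?_
    exact_mod_cast Nat.lt_succ_self N
  have h3 : FiniteDimensional ℂ (expPolyDomain nu lam N) :=
    Submodule.finiteDimensional_of_le h2
  have h4 : expPolySpace nu lam N ≤ LinearMap.range (expPolyMap nu lam N) := by
    rintro f ⟨p, hp, hf⟩
    have hm := (memLp_congr_ae hf).1 (Lp.memLp f)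
    refine ⟨⟨p, hp, hm⟩, ?_⟩
    apply Lp.ext
    exact hm.coeFn_toLp.trans hf.symm
  exact Submodule.finiteDimensional_of_le h4

/-- The `L²_{ω^ν}`-orthogonal projection `Π_N^{ν,λ}` onto `{e^{-λ x} p : p ∈ 𝒫_N}`. -/
def laguerreProj (nu lam : ℝ) (N : ℕ) :
    Lp ℂ 2 (weightMeasure nu) →L[ℂ] Lp ℂ 2 (weightMeasure nu) :=
  (expPolySpace nu lam N).starProjection

end

/-! The functions $\ell^a_n=e^{-\lambda x}\,\frac{n!}{\Gamma(n+a+1)}L^{(a)}_n(2\lambda x)$ form a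
complete orthogonal system of $L^2_{\omega^a}$, and with this normalization the coefficients
$c_n(v)=(\ell^{\nu}_n,v)_{\omega^\nu}$ do not change under differentiation:
$(\ell^{\nu+s}_n,{}_xD^{s,\lambda}_\infty v)_{\omega^{\nu+s}}=c_n(v)$. Indeed, pairing with
$\ell^a_n$ is a combination of moments, the $i$-th with factor $(-2\lambda)^i\binom
ni/\Gamma(a+1+i)$, and the Riemann–Liouville derivative preserves the normalized moments
$\Gamma(b)^{-1}\int_0^\infty x^{b-1}f$ when $b$ moves to $b+s$ (`IsRightRLDeriv.moment`,
`inner_laguerrePoly_rightTemperedDeriv`).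

Parseval (`hasSum_laguerreWeight_mul_norm_sq`) therefore gives, for every admissible $s$,
$\|{}_xD^{s,\lambda}_\infty v\|^2_{\omega^{\nu+s}}=\sum_n w_n(\nu+s)|c_n(v)|^2$ with
$w_n(a)=(2\lambda)^{a+1}\Gamma(a+1+n)/n!$. The projection error has $c_n=0$ for $n\le N$ and
$c_n=-c_n(u)$ for $n>N$. On the remaining indices log-convexity of $\Gamma$ yields
$w_n(\nu+s)\le(2\lambda N)^{s-r}w_n(\nu+r)$ (`laguerreWeight_le`), so the estimate holds with
$c_N=1$.

Two analytic points remain. The moment identity needs the test function $x^{b+s-1}$, which is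
reached through cutoffs in the variable $\log x$. Completeness follows because an exponentially
decaying function with vanishing moments has vanishing Fourier transform. -/

/-! ### Weighted measures and polynomials times exponentials. -/

theorem ae_weightMeasure (a : ℝ) :
    ae (weightMeasure a) = ae (volume.restrict (Ioi (0 : ℝ))) := by
  apply le_antisymm
  · exact (withDensity_absolutelyContinuous _ _).ae_le
  · refine (withDensity_absolutelyContinuous' (by fun_prop) ?_).ae_le
    filter_upwards [ae_restrict_mem measurableSet_Ioi] with x hx
    have := Real.rpow_pos_of_pos hx a
    simpa using this

theorem integrable_weightMeasure_iff {a : ℝ} {f : ℝ → ℂ} :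
    Integrable f (weightMeasure a) ↔ IntegrableOn (fun x => ((x ^ a : ℝ) : ℂ) * f x) (Ioi 0) := by
  rw [weightMeasure, integrable_withDensity_iff_integrable_smul' (by fun_prop) (by simp)]
  apply integrable_congr
  filter_upwards [ae_restrict_mem measurableSet_Ioi] with x hx
  rw [ENNReal.toReal_ofReal (Real.rpow_nonneg (le_of_lt hx) _), Complex.real_smul]

theorem integral_weightMeasure (a : ℝ) (f : ℝ → ℂ) :
    ∫ x, f x ∂(weightMeasure a) = ∫ x in Ioi 0, ((x ^ a : ℝ) : ℂ) * f x := by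
  rw [weightMeasure, integral_withDensity_eq_integral_toReal_smul (by fun_prop) (by simp)]
  apply integral_congr_ae
  filter_upwards [ae_restrict_mem measurableSet_Ioi] with x hx
  rw [ENNReal.toReal_ofReal (Real.rpow_nonneg (le_of_lt hx) _), Complex.real_smul]

theorem MeasureTheory.MemLp.integrableOn_weight_mul {a : ℝ} {f g : ℝ → ℂ}
    (hf : MemLp f 2 (weightMeasure a)) (hg : MemLp g 2 (weightMeasure a)) :
    IntegrableOn (fun x => ((x ^ a : ℝ) : ℂ) * (f x * g x)) (Ioi 0) :=
  integrable_weightMeasure_iff.1 (hf.integrable_mul hg)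

theorem integrableOn_rpow_mul_exp {c m : ℝ} (hc : -1 < c) (hm : 0 < m) :
    IntegrableOn (fun x : ℝ => x ^ c * Real.exp (-(m * x))) (Ioi 0) := by
  have := integrableOn_rpow_mul_exp_neg_mul_rpow (p := 1) hc one_pos hm
  simpa using this

theorem memLp_temper_pow {a lam : ℝ} (ha : -1 < a) (hl : 0 < lam) (j : ℕ) :
    MemLp (temper lam (fun x => (x : ℂ) ^ j)) 2 (weightMeasure a) := by
  have hm : AEStronglyMeasurable (temper lam (fun x => (x : ℂ) ^ j)) (weightMeasure a) := by
    unfold temper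
    exact (by fun_prop : Continuous _).aestronglyMeasurable
  rw [memLp_two_iff_integrable_sq_norm hm]
  suffices H : Integrable (fun x => ((‖temper lam (fun x => (x : ℂ) ^ j) x‖ ^ 2 : ℝ) : ℂ))
      (weightMeasure a) by
    simpa only [RCLike.re_to_complex, Complex.ofReal_re] using H.re
  rw [integrable_weightMeasure_iff]
  have h := (integrableOn_rpow_mul_exp (c := a + (2 * j : ℕ)) (m := 2 * lam)
    (by have : (0 : ℝ) ≤ (2 * j : ℕ) := by positivity
        linarith) (by positivity)).ofReal (𝕜 := ℂ)
  refine h.congr ?_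
  filter_upwards [ae_restrict_mem measurableSet_Ioi] with x (hx : 0 < x)
  rw [Real.rpow_add hx, Real.rpow_natCast]
  simp only [temper, norm_mul, norm_pow, Complex.norm_real, Real.norm_eq_abs, Real.abs_exp,
    abs_of_pos hx]
  have : Real.exp (-(2 * lam * x)) = Real.exp (-(lam * x)) ^ 2 := by
    rw [← Real.exp_nat_mul]; congr 1; push_cast; ring
  rw [this]
  push_cast
  simp only [Complex.coe_algebraMap]
  simp
  ring

theorem temper_eval_eq_sum (lam : ℝ) (p : Polynomial ℂ) :
    temper lam (fun x => p.eval (x : ℂ)) =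
      fun x => ∑ i ∈ p.support, p.coeff i * temper lam (fun x => (x : ℂ) ^ i) x := by
  ext x
  simp only [temper, Polynomial.eval_eq_sum, Polynomial.sum, Finset.mul_sum]
  exact Finset.sum_congr rfl fun i _ => by ring

theorem memLp_temper_eval {a lam : ℝ} (ha : -1 < a) (hl : 0 < lam) (p : Polynomial ℂ) :
    MemLp (temper lam (fun x => p.eval (x : ℂ))) 2 (weightMeasure a) := by
  rw [temper_eval_eq_sum]
  exact memLp_finsetSum _ fun i _ => (memLp_temper_pow ha hl i).const_mul _

theorem integrableOn_rpow_mul_temper {a lam : ℝ} (ha : -1 < a) (hl : 0 < lam) {u : ℝ → ℂ}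
    (hu : MemLp u 2 (weightMeasure a)) (j : ℕ) :
    IntegrableOn (fun x => ((x ^ (a + j) : ℝ) : ℂ) * temper lam u x) (Ioi 0) := by
  refine ((memLp_temper_pow ha hl j).integrableOn_weight_mul hu).congr_fun ?_ measurableSet_Ioi
  intro x (hx : 0 < x)
  simp only [temper]
  rw [Real.rpow_add hx, Real.rpow_natCast]
  push_cast
  ring

/-! ### Beta integrals and moments of the Riemann–Liouville integral. -/

theorem integral_rpow_mul_sub_rpow {b κ y : ℝ} (hb : 0 < b) (hκ : 0 < κ) (hy : 0 < y) :
    ∫ x in Ioo 0 y, x ^ (b - 1) * (y - x) ^ (κ - 1) =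
      y ^ (b + κ - 1) * (Real.Gamma b * Real.Gamma κ / Real.Gamma (b + κ)) := by
  have h := Complex.betaIntegral_scaled (b : ℂ) (κ : ℂ) hy
  rw [Complex.betaIntegral_eq_Gamma_mul_div _ _ (by simpa using hb) (by simpa using hκ),
    intervalIntegral.integral_of_le hy.le, integral_Ioc_eq_integral_Ioo] at h
  have h2 : ∫ x in Ioo 0 y, (x : ℂ) ^ ((b : ℂ) - 1) * ((y : ℂ) - x) ^ ((κ : ℂ) - 1) =
      ((∫ x in Ioo 0 y, x ^ (b - 1) * (y - x) ^ (κ - 1) : ℝ) : ℂ) := by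
    rw [← integral_complex_ofReal]
    refine setIntegral_congr_fun measurableSet_Ioo fun x hx => ?_
    simp only [Complex.ofReal_mul]
    rw [Complex.ofReal_cpow hx.1.le, Complex.ofReal_cpow (sub_nonneg.2 hx.2.le)]
    push_cast
    rfl
  rw [h2, Complex.Gamma_ofReal, Complex.Gamma_ofReal, ← Complex.ofReal_add,
    Complex.Gamma_ofReal] at h
  have h3 : (y : ℂ) ^ (((b + κ : ℝ) : ℂ) - 1) = ((y ^ (b + κ - 1) : ℝ) : ℂ) := by
    rw [Complex.ofReal_cpow hy.le]
    push_cast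
    rfl
  rw [h3] at h
  exact_mod_cast h

/-- The integral of a non-integrable function is $0$ by convention, whereas the beta value is
positive. -/
theorem integrableOn_rpow_mul_sub_rpow {b κ y : ℝ} (hb : 0 < b) (hκ : 0 < κ) (hy : 0 < y) :
    IntegrableOn (fun x => x ^ (b - 1) * (y - x) ^ (κ - 1)) (Ioo 0 y) := by
  by_contra h
  have h1 := integral_undef h
  rw [integral_rpow_mul_sub_rpow hb hκ hy] at h1
  have := Real.Gamma_pos_of_pos hb
  have := Real.Gamma_pos_of_pos hκ
  have := Real.Gamma_pos_of_pos (add_pos hb hκ)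
  have := Real.rpow_pos_of_pos hy (b + κ - 1)
  exact absurd h1 (by positivity)

theorem aestronglyMeasurable_of_rpow_mul {c : ℝ} {f : ℝ → ℂ}
    (hf : AEStronglyMeasurable (fun x => ((x ^ c : ℝ) : ℂ) * f x) (volume.restrict (Ioi 0))) :
    AEStronglyMeasurable f (volume.restrict (Ioi (0 : ℝ))) := by
  have h : AEStronglyMeasurable (fun x : ℝ => ((x ^ (-c) : ℝ) : ℂ)) (volume.restrict (Ioi 0)) :=
    (by fun_prop : Measurable fun x : ℝ => ((x ^ (-c) : ℝ) : ℂ)).aestronglyMeasurable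
  refine (h.mul hf).congr ?_
  filter_upwards [ae_restrict_mem measurableSet_Ioi] with x (hx : 0 < x)
  simp only [Pi.mul_apply]
  rw [← mul_assoc, ← Complex.ofReal_mul, ← Real.rpow_add hx]
  simp

/-- Tonelli's theorem: for fixed $y$ the integral over $x\in(0,y)$ is a beta integral, so
integrability on the product reduces to that of $y^{b+κ-1}f(y)$. The indicator of $\{x<y\}$ turns
the triangular domain into a product. -/
theorem integrable_rightRL_prod {κ b : ℝ} (hκ : 0 < κ) (hb : 0 < b) {f : ℝ → ℂ}
    (hf : IntegrableOn (fun x => ((x ^ (b + κ - 1) : ℝ) : ℂ) * f x) (Ioi 0)) :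
    Integrable (fun p : ℝ × ℝ => {q : ℝ × ℝ | q.1 < q.2}.indicator
        (fun q => ((q.1 ^ (b - 1) * (q.2 - q.1) ^ (κ - 1) : ℝ) : ℂ)) p * f p.2)
      ((volume.restrict (Ioi 0)).prod (volume.restrict (Ioi 0))) ∧
    ∀ᵐ y ∂(volume.restrict (Ioi (0 : ℝ))), ∫ x in Ioi 0, {q : ℝ × ℝ | q.1 < q.2}.indicator
        (fun q => ((q.1 ^ (b - 1) * (q.2 - q.1) ^ (κ - 1) : ℝ) : ℂ)) (x, y) * f y =
      ((Real.Gamma b * Real.Gamma κ / Real.Gamma (b + κ) : ℝ) : ℂ) *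
        (((y ^ (b + κ - 1) : ℝ) : ℂ) * f y) := by
  have hms : MeasurableSet {q : ℝ × ℝ | q.1 < q.2} := measurableSet_lt measurable_fst measurable_snd
  have hsec : ∀ y : ℝ, 0 < y → ∀ x ∈ Ioi (0 : ℝ), {q : ℝ × ℝ | q.1 < q.2}.indicator
        (fun q => ((q.1 ^ (b - 1) * (q.2 - q.1) ^ (κ - 1) : ℝ) : ℂ)) (x, y) =
      (Ioo 0 y).indicator (fun x => ((x ^ (b - 1) * (y - x) ^ (κ - 1) : ℝ) : ℂ)) x := by
    intro y hy x hx
    by_cases h : x < y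
    · rw [indicator_of_mem (by exact h), indicator_of_mem (by exact ⟨hx, h⟩)]
    · rw [indicator_of_notMem (by exact h), indicator_of_notMem (by exact fun h' => h h'.2)]
  have hI : ∀ y : ℝ, 0 < y → IntegrableOn
      ((Ioo 0 y).indicator (fun x => ((x ^ (b - 1) * (y - x) ^ (κ - 1) : ℝ) : ℂ))) (Ioi 0) := by
    intro y hy
    have := (integrableOn_rpow_mul_sub_rpow hb hκ hy).ofReal (𝕜 := ℂ)
    exact ((integrable_indicator_iff measurableSet_Ioo).2 this).integrableOn
  have hint : ∀ y : ℝ, 0 < y → ∀ (E : Type) [NormedAddCommGroup E] [NormedSpace ℝ E] (F : ℝ → E),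
      ∫ x in Ioi 0, (Ioo 0 y).indicator F x = ∫ x in Ioo 0 y, F x := by
    intro y hy E _ _ F
    rw [setIntegral_indicator measurableSet_Ioo, inter_eq_self_of_subset_right Ioo_subset_Ioi_self]
  constructor
  · rw [integrable_prod_iff']
    · constructor
      · filter_upwards [ae_restrict_mem measurableSet_Ioi] with y (hy : 0 < y)
        exact ((hI y hy).congr_fun (fun x hx => (hsec y hy x hx).symm) measurableSet_Ioi).mul_const _
      · refine (hf.norm.const_mul (Real.Gamma b * Real.Gamma κ / Real.Gamma (b + κ))).congr ?_
        filter_upwards [ae_restrict_mem measurableSet_Ioi] with y (hy : 0 < y)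
        simp only [norm_mul]
        rw [integral_mul_const, setIntegral_congr_fun (g := (Ioo 0 y).indicator
          fun x => x ^ (b - 1) * (y - x) ^ (κ - 1)) measurableSet_Ioi, hint y hy,
          integral_rpow_mul_sub_rpow hb hκ hy, Complex.norm_real,
          Real.norm_of_nonneg (Real.rpow_nonneg hy.le _)]
        · ring
        · intro x hx
          simp only
          rw [hsec y hy x hx, norm_indicator_eq_indicator_norm]
          by_cases h : x ∈ Ioo 0 y
          · rw [indicator_of_mem h, indicator_of_mem h, Complex.norm_real, Real.norm_of_nonneg]
            exact mul_nonneg (Real.rpow_nonneg h.1.le _) (Real.rpow_nonneg (sub_nonneg.2 h.2.le) _)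
          · rw [indicator_of_notMem h, indicator_of_notMem h]
    · refine AEStronglyMeasurable.mul ?_ ?_
      · refine (Measurable.indicator ?_ hms).aestronglyMeasurable
        fun_prop
      · exact (aestronglyMeasurable_of_rpow_mul hf.aestronglyMeasurable).comp_snd
  · filter_upwards [ae_restrict_mem measurableSet_Ioi] with y (hy : 0 < y)
    rw [integral_mul_const, setIntegral_congr_fun measurableSet_Ioi (hsec y hy), hint y hy,
      integral_complex_ofReal, integral_rpow_mul_sub_rpow hb hκ hy]
    push_cast
    ring

theorem rightRLIntegral_moment {κ b : ℝ} (hκ : 0 < κ) (hb : 0 < b) {f : ℝ → ℂ}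
    (hf : IntegrableOn (fun x => ((x ^ (b + κ - 1) : ℝ) : ℂ) * f x) (Ioi 0)) :
    IntegrableOn (fun x => ((x ^ (b - 1) : ℝ) : ℂ) * rightRLIntegral κ f x) (Ioi 0) ∧
    ∫ x in Ioi 0, ((x ^ (b - 1) : ℝ) : ℂ) * rightRLIntegral κ f x =
      ((Real.Gamma b / Real.Gamma (b + κ) : ℝ) : ℂ) *
        ∫ x in Ioi 0, ((x ^ (b + κ - 1) : ℝ) : ℂ) * f x := by
  obtain ⟨h1, h2⟩ := integrable_rightRL_prod hκ hb hf
  have key : ∀ x ∈ Ioi (0 : ℝ), ((1 / Real.Gamma κ : ℝ) : ℂ) *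
      ∫ y in Ioi 0, {q : ℝ × ℝ | q.1 < q.2}.indicator
        (fun q => ((q.1 ^ (b - 1) * (q.2 - q.1) ^ (κ - 1) : ℝ) : ℂ)) (x, y) * f y =
      ((x ^ (b - 1) : ℝ) : ℂ) * rightRLIntegral κ f x := by
    intro x (hx : 0 < x)
    have : ∀ y, {q : ℝ × ℝ | q.1 < q.2}.indicator
        (fun q => ((q.1 ^ (b - 1) * (q.2 - q.1) ^ (κ - 1) : ℝ) : ℂ)) (x, y) * f y =
        ((x ^ (b - 1) : ℝ) : ℂ) * (Ioi x).indicator (rightRLKernel κ f x) y := by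
      intro y
      by_cases h : x < y
      · rw [indicator_of_mem (by exact h), indicator_of_mem (by exact h), rightRLKernel]
        push_cast
        ring
      · rw [indicator_of_notMem (by exact h), indicator_of_notMem (by exact h)]
        simp
    simp_rw [this]
    rw [integral_const_mul, setIntegral_indicator measurableSet_Ioi,
      inter_eq_self_of_subset_right (Ioi_subset_Ioi hx.le), rightRLIntegral]
    ring
  constructor
  · exact (h1.integral_prod_left.const_mul _).congr
      ((ae_restrict_iff' measurableSet_Ioi).2 (ae_of_all _ key))
  · rw [← setIntegral_congr_fun measurableSet_Ioi key, integral_const_mul,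
      integral_integral_swap h1, integral_congr_ae h2, integral_const_mul, ← mul_assoc,
      ← Complex.ofReal_mul]
    congr 2
    have := (Real.Gamma_pos_of_pos hκ).ne'
    field_simp

/-! ### Logarithmic cutoffs and moments of fractional derivatives. -/

/-- A sequence of smooth functions, bounded together with all derivatives uniformly in the index,
that converges pointwise to the constant `L` while all its derivatives converge to `0`. -/
structure SlowlyVaryingTo (ψ : ℕ → ℝ → ℝ) (L : ℝ) : Prop where
  contDiff : ∀ n, ContDiff ℝ (⊤ : ℕ∞) (ψ n)
  bounded : ∀ m, ∃ C, ∀ n t, |iteratedDeriv m (ψ n) t| ≤ C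
  tendsto : ∀ m t, Tendsto (fun n => iteratedDeriv m (ψ n) t) atTop (𝓝 (if m = 0 then L else 0))

/-- This is the effect of one differentiation: $(x^c\psi(\log x))'=x^{c-1}(c\psi+\psi')(\log x)$. -/
theorem SlowlyVaryingTo.const_mul_add_deriv {ψ : ℕ → ℝ → ℝ} {L : ℝ} (h : SlowlyVaryingTo ψ L)
    (c : ℝ) : SlowlyVaryingTo (fun n t => c * ψ n t + deriv (ψ n) t) (c * L) := by
  have hd : ∀ n, ContDiff ℝ (⊤ : ℕ∞) (deriv (ψ n)) := fun n =>
    (contDiff_infty_iff_deriv.1 (h.contDiff n)).2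
  have key : ∀ m n t, iteratedDeriv m (fun t => c * ψ n t + deriv (ψ n) t) t =
      c * iteratedDeriv m (ψ n) t + iteratedDeriv (m + 1) (ψ n) t := by
    intro m n t
    have h1 : ContDiff ℝ m (ψ n) := (h.contDiff n).of_le (by exact_mod_cast le_top)
    have h2 : ContDiff ℝ m (deriv (ψ n)) := (hd n).of_le (by exact_mod_cast le_top)
    rw [iteratedDeriv_fun_add (contDiff_const.mul h1).contDiffAt h2.contDiffAt,
      iteratedDeriv_succ', iteratedDeriv_const_mul_field]
  refine ⟨fun n => (contDiff_const.mul (h.contDiff n)).add (hd n), fun m => ?_, fun m t => ?_⟩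
  · obtain ⟨C, hC⟩ := h.bounded m
    obtain ⟨D, hD⟩ := h.bounded (m + 1)
    refine ⟨|c| * C + D, fun n t => ?_⟩
    rw [key]
    refine (abs_add_le _ _).trans (add_le_add ?_ (hD n t))
    rw [abs_mul]
    exact mul_le_mul_of_nonneg_left (hC n t) (abs_nonneg c)
  · simp_rw [key]
    have := ((h.tendsto m t).const_mul c).add (h.tendsto (m + 1) t)
    convert this using 2
    split_ifs <;> simp_all

theorem SlowlyVaryingTo.tendsto_integral {ψ : ℕ → ℝ → ℝ} {L : ℝ} (h : SlowlyVaryingTo ψ L)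
    {F : ℝ → ℂ} (hF : IntegrableOn F (Ioi 0)) :
    Tendsto (fun n => ∫ x in Ioi 0, ((ψ n (Real.log x) : ℝ) : ℂ) * F x) atTop
      (𝓝 ((L : ℂ) * ∫ x in Ioi 0, F x)) := by
  obtain ⟨C, hC⟩ := h.bounded 0
  rw [← integral_const_mul]
  refine tendsto_integral_of_dominated_convergence (fun x => C * ‖F x‖) (fun n => ?_)
    (hF.norm.const_mul C) (fun n => ae_of_all _ fun x => ?_) (ae_of_all _ fun x => ?_)
  · have := (h.contDiff n).continuous.measurable
    exact (by fun_prop : Measurable fun x : ℝ =>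
      ((ψ n (Real.log x) : ℝ) : ℂ)).aestronglyMeasurable.mul hF.aestronglyMeasurable
  · rw [norm_mul, Complex.norm_real]
    exact mul_le_mul_of_nonneg_right (by simpa using hC n (Real.log x)) (norm_nonneg _)
  · have := h.tendsto 0 (Real.log x)
    simp only [iteratedDeriv_zero, if_true] at this
    exact ((Complex.continuous_ofReal.tendsto _).comp this).mul_const _

/-- Differentiation keeps the shape "power times slowly varying function of $\log x$". Derivatives
of the cutoff vanish in the limit, which leaves the falling factorial from differentiating $x^c$. -/
theorem SlowlyVaryingTo.iteratedDeriv_rpow_mul {ψ : ℕ → ℝ → ℝ} {L : ℝ} (h : SlowlyVaryingTo ψ L)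
    {c : ℝ} {φ : ℕ → ℝ → ℝ} (hφ : ∀ n, EqOn (φ n) (fun x => x ^ c * ψ n (Real.log x)) (Ioi 0))
    (k : ℕ) : ∃ ψ', SlowlyVaryingTo ψ' ((∏ i ∈ Finset.range k, (c - i)) * L) ∧
      ∀ n, EqOn (iteratedDeriv k (φ n)) (fun x => x ^ (c - k) * ψ' n (Real.log x)) (Ioi 0) := by
  induction k with
  | zero => exact ⟨ψ, by simpa using h, by simpa using hφ⟩
  | succ k ih =>
    obtain ⟨ψ', h', he⟩ := ih
    refine ⟨fun n t => (c - k) * ψ' n t + deriv (ψ' n) t, ?_, fun n x (hx : 0 < x) => ?_⟩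
    · rw [Finset.prod_range_succ, mul_comm _ (c - (k : ℝ)), mul_assoc]
      exact h'.const_mul_add_deriv _
    · rw [iteratedDeriv_succ, ((he n).eventuallyEq_of_mem (Ioi_mem_nhds hx)).deriv_eq]
      have h1 := Real.hasDerivAt_rpow_const (x := x) (p := c - k) (Or.inl hx.ne')
      have h2 : HasDerivAt (ψ' n) _ (Real.log x) :=
        ((h'.contDiff n).differentiable (by simp) _).hasDerivAt
      refine (h1.mul (h2.comp x (Real.hasDerivAt_log hx.ne'))).deriv.trans ?_
      have h3 : x ^ (c - k) = x ^ (c - k - 1) * x := by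
        rw [Real.rpow_sub_one hx.ne', div_mul_cancel₀ _ hx.ne']
      have h4 : c - (k + 1 : ℕ) = c - k - 1 := by push_cast; ring
      rw [h4, h3]
      simp only [Function.comp_apply]
      field_simp

/-- Each derivative brings out a factor $1/(n+1)\le1$. -/
theorem slowlyVaryingTo_comp_div {η : ℝ → ℝ} (h : ContDiff ℝ (⊤ : ℕ∞) η)
    (hs : HasCompactSupport η) :
    SlowlyVaryingTo (fun n t => η ((n + 1 : ℝ)⁻¹ * t)) (η 0) := by
  have key : ∀ m n t, iteratedDeriv m (fun t => η ((n + 1 : ℝ)⁻¹ * t)) t =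
      ((n + 1 : ℝ)⁻¹) ^ m * iteratedDeriv m η ((n + 1 : ℝ)⁻¹ * t) := by
    intro m n t
    have := iteratedDeriv_comp_const_mul (n := m) (h.of_le (by exact_mod_cast le_top)) (n + 1 : ℝ)⁻¹
    exact congrFun this t
  have hc : ∀ m, Continuous (iteratedDeriv m η) := fun m =>
    h.continuous_iteratedDeriv m (by exact_mod_cast le_top)
  have hsm : ∀ m, HasCompactSupport (iteratedDeriv m η) := by
    intro m
    induction m with
    | zero => simpa using hs
    | succ m ih => rw [iteratedDeriv_succ]; exact ih.deriv
  refine ⟨fun n => h.comp (contDiff_const.mul contDiff_id), fun m => ?_, fun m t => ?_⟩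
  · obtain ⟨C, hC⟩ := (hsm m).exists_bound_of_continuous (hc m)
    refine ⟨C, fun n t => ?_⟩
    have := key m n t
    rw [this, abs_mul]
    have h1 : |((n + 1 : ℝ)⁻¹) ^ m| ≤ 1 := by
      rw [abs_of_nonneg (by positivity)]
      exact pow_le_one₀ (by positivity) (inv_le_one_of_one_le₀ (by linarith [n.cast_nonneg (α := ℝ)]))
    calc _ ≤ 1 * C := mul_le_mul h1 (hC _) (abs_nonneg _) zero_le_one
      _ = C := one_mul C
  · have e : Tendsto (fun n : ℕ => (n + 1 : ℝ)⁻¹) atTop (𝓝 0) := by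
      simpa using tendsto_one_div_add_atTop_nhds_zero_nat (𝕜 := ℝ)
    have h1 := (e.pow m).mul (((hc m).tendsto (0 * t)).comp (e.mul_const t))
    have h2 : (if m = 0 then η 0 else 0) = 0 ^ m * iteratedDeriv m η (0 * t) := by
      rcases Nat.eq_zero_or_pos m with rfl | hm
      · simp
      · simp [hm.ne']
    rw [h2]
    exact h1.congr fun n => (key m n t).symm

theorem Gamma_add_one_eq_prod (c : ℝ) (k : ℕ) (h : 0 < c + 1 - k) :
    Real.Gamma (c + 1) = (∏ i ∈ Finset.range k, (c - i)) * Real.Gamma (c + 1 - k) := by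
  induction k with
  | zero => simp
  | succ k ih =>
    push_cast at h
    rw [ih (by linarith), Finset.prod_range_succ, mul_assoc]
    congr 1
    have : c + 1 - k = (c - k) + 1 := by ring
    rw [this, Real.Gamma_add_one (by linarith)]
    congr 2
    push_cast
    ring

/-- Test functions on `(0, ∞)` approximating `x ↦ x ^ c`. -/
theorem exists_cutoff_rpow (c : ℝ) : ∃ ψ : ℕ → ℝ → ℝ, ∃ φ : ℕ → ℝ → ℝ, SlowlyVaryingTo ψ 1 ∧
    (∀ n, EqOn (φ n) (fun x => x ^ c * ψ n (Real.log x)) (Ioi 0)) ∧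
    ∀ n, ContDiff ℝ (⊤ : ℕ∞) (φ n) ∧ HasCompactSupport (φ n) ∧ tsupport (φ n) ⊆ Ioi 0 := by
  let η : ContDiffBump (0 : ℝ) := ⟨1, 2, one_pos, one_lt_two⟩
  have hη : ContDiff ℝ (⊤ : ℕ∞) η := η.contDiff
  have h1 := slowlyVaryingTo_comp_div hη η.hasCompactSupport
  have h10 : η 0 = 1 := η.one_of_mem_closedBall (by simp [η])
  rw [h10] at h1
  -- The indicator is needed because `Real.log` is even with value $0$ at $0$, so the bump would not
  -- vanish at $0$ or on the negative axis.
  let φ : ℕ → ℝ → ℝ := fun n => (Ioi (0 : ℝ)).indicator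
    fun x => x ^ c * η ((n + 1 : ℝ)⁻¹ * Real.log x)
  have hsupp : ∀ n, Function.support (φ n) ⊆
      Icc (Real.exp (-(2 * (n + 1)))) (Real.exp (2 * (n + 1))) := by
    intro n x hx
    have hx0 : 0 < x := by
      by_contra h
      exact hx (indicator_of_notMem (by exact h) _)
    have hx1 : η ((n + 1 : ℝ)⁻¹ * Real.log x) ≠ 0 := by
      intro h
      apply hx
      simp [φ, h]
    have hx2 : (n + 1 : ℝ)⁻¹ * Real.log x ∈ Metric.ball (0 : ℝ) 2 := by
      have : (n + 1 : ℝ)⁻¹ * Real.log x ∈ Function.support η := hx1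
      rwa [η.support_eq] at this
    have hn : (0 : ℝ) < n + 1 := by positivity
    rw [mem_ball_zero_iff, Real.norm_eq_abs, abs_lt, inv_mul_eq_div, lt_div_iff₀ hn,
      div_lt_iff₀ hn] at hx2
    constructor
    · rw [← Real.le_log_iff_exp_le hx0]; linarith
    · rw [← Real.log_le_iff_le_exp hx0]; linarith
  have hts : ∀ n, tsupport (φ n) ⊆ Icc (Real.exp (-(2 * (n + 1)))) (Real.exp (2 * (n + 1))) :=
    fun n => closure_minimal (hsupp n) isClosed_Icc
  have hts' : ∀ n, tsupport (φ n) ⊆ Ioi 0 := fun n x hx =>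
    (Real.exp_pos _).trans_le (hts n hx).1
  have heq : ∀ n, EqOn (φ n) (fun x => x ^ c * η ((n + 1 : ℝ)⁻¹ * Real.log x)) (Ioi 0) :=
    fun n x hx => indicator_of_mem hx _
  refine ⟨_, φ, h1, heq, fun n => ⟨?_, ?_, hts' n⟩⟩
  · rw [contDiff_iff_contDiffAt]
    intro x
    by_cases hx : x ∈ tsupport (φ n)
    · have hx0 : 0 < x := hts' n hx
      refine ContDiffAt.congr_of_eventuallyEq ?_ ((heq n).eventuallyEq_of_mem (Ioi_mem_nhds hx0))
      refine (contDiffAt_id.rpow_const_of_ne hx0.ne').mul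
        (hη.contDiffAt.comp x (contDiffAt_const.mul (Real.contDiffAt_log.2 hx0.ne')))
    · exact (contDiffAt_const (c := (0 : ℝ))).congr_of_eventuallyEq
        (notMem_tsupport_iff_eventuallyEq.1 hx)
  · exact isCompact_Icc.of_isClosed_subset (isClosed_tsupport _) (hts n)

/-- The weak identity is tested against cutoffs of $x^{a+s-1}$. In the limit the $k$ derivatives
give $\Gamma(a+s)/\Gamma(a+s-k)$, and the moment formula for the integral of order $k-s$ gives
$\Gamma(a+s-k)/\Gamma(a)$. No boundary terms arise, since the cutoffs have compact support in
$(0,\infty)$. -/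
theorem IsRightRLDeriv.moment {s a : ℝ} {f g : ℝ → ℂ} (h : IsRightRLDeriv s f g)
    (hs : 0 ≤ s) (ha : 1 < a) (hf : IntegrableOn (fun x => ((x ^ (a - 1) : ℝ) : ℂ) * f x) (Ioi 0))
    (hg : IntegrableOn (fun x => ((x ^ (a + s - 1) : ℝ) : ℂ) * g x) (Ioi 0)) :
    (Real.Gamma (a + s) : ℂ)⁻¹ * ∫ x in Ioi 0, ((x ^ (a + s - 1) : ℝ) : ℂ) * g x =
      (Real.Gamma a : ℂ)⁻¹ * ∫ x in Ioi 0, ((x ^ (a - 1) : ℝ) : ℂ) * f x := by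
  have hk1 : s < (⌊s⌋₊ + 1 : ℕ) := by exact_mod_cast Nat.lt_floor_add_one s
  have hk2 : ((⌊s⌋₊ + 1 : ℕ) : ℝ) ≤ s + 1 := by
    have := Nat.floor_le hs
    push_cast; linarith
  obtain ⟨-, -, -, h⟩ := h
  generalize ⌊s⌋₊ + 1 = k at *
  -- This is where $a>1$ enters, as $k$ can be as large as $s+1$.
  have hb : 0 < a + s - k := by linarith
  have e1 : a + s - k + (k - s) - 1 = a - 1 := by ring
  obtain ⟨hF, hF'⟩ := rightRLIntegral_moment (f := f) (sub_pos.2 hk1) hb (by rwa [e1])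
  obtain ⟨ψ, φ, hψ, hφ, hφ'⟩ := exists_cutoff_rpow (a + s - 1)
  obtain ⟨ψ', hψ', hder⟩ := hψ.iteratedDeriv_rpow_mul hφ k
  have l1 := hψ.tendsto_integral hg
  have l2 := hψ'.tendsto_integral hF
  have e2 : ∀ n, ∫ x in Ioi 0, ((ψ n (Real.log x) : ℝ) : ℂ) * (((x ^ (a + s - 1) : ℝ) : ℂ) * g x) =
      ∫ x in Ioi 0, ((ψ' n (Real.log x) : ℝ) : ℂ) *
        (((x ^ (a + s - k - 1) : ℝ) : ℂ) * rightRLIntegral (k - s) f x) := by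
    intro n
    have := h (φ n) (hφ' n).1 (hφ' n).2.1 (hφ' n).2.2
    rw [setIntegral_congr_fun measurableSet_Ioi (g := fun x => ((φ n x : ℝ) : ℂ) * g x), ← this]
    · refine setIntegral_congr_fun measurableSet_Ioi fun x hx => ?_
      rw [hder n hx, sub_right_comm]
      push_cast
      ring
    · intro x hx
      beta_reduce
      rw [hφ n hx]
      push_cast
      ring
  simp_rw [e2] at l1
  have := tendsto_nhds_unique l1 l2
  have hG := Gamma_add_one_eq_prod (a + s - 1) k (by linarith)
  rw [hF', e1] at this
  have e3 : a + s - k + (k - s) = a := by ring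
  have e4 : a + s - 1 + 1 = a + s := by ring
  rw [e3] at this
  rw [e4] at hG
  have p1 := (Real.Gamma_pos_of_pos (by linarith : 0 < a + s)).ne'
  have p2 := (Real.Gamma_pos_of_pos (by linarith : 0 < a)).ne'
  have e5 : (∏ i ∈ Finset.range k, (a + s - 1 - i)) * 1 * (Real.Gamma (a + s - k) / Real.Gamma a) =
    Real.Gamma (a + s) / Real.Gamma a := by rw [hG]; ring
  rw [← mul_assoc, ← Complex.ofReal_mul, e5, Complex.ofReal_one, one_mul] at this
  rw [this]
  have p1' : (Real.Gamma (a + s) : ℂ) ≠ 0 := by exact_mod_cast p1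
  push_cast
  field_simp

/-! ### Moment determinacy under exponential decay. -/

theorem integrableOn_pow_mul_exp_mul {δ : ℝ} (hδ : 0 < δ) {G : ℝ → ℂ}
    (hG : IntegrableOn (fun x => ((Real.exp (2 * δ * x) : ℝ) : ℂ) * G x) (Ioi 0)) (j : ℕ) :
    IntegrableOn (fun x => ((x ^ j * Real.exp (δ * x) : ℝ) : ℂ) * G x) (Ioi 0) := by
  have hm : AEStronglyMeasurable (fun x : ℝ => ((x ^ j * Real.exp (-(δ * x)) : ℝ) : ℂ))
      (volume.restrict (Ioi 0)) := (by fun_prop : Continuous _).aestronglyMeasurable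
  -- The bound $x^je^{-\delta x}\le j!/\delta^j$ comes from a single term of the exponential series.
  refine (hG.bdd_mul (c := (j.factorial / δ ^ j : ℝ)) hm ?_).congr ?_
  · filter_upwards [ae_restrict_mem measurableSet_Ioi] with x (hx : 0 < x)
    rw [Complex.norm_real, Real.norm_of_nonneg (by positivity)]
    have h1 := Real.pow_div_factorial_le_exp (δ * x) (by positivity) j
    rw [div_le_iff₀ (by positivity), mul_pow] at h1
    rw [Real.exp_neg, ← div_eq_mul_inv, div_le_div_iff₀ (by positivity) (by positivity)]
    nlinarith
  · refine ae_of_all _ fun x => ?_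
    have : Real.exp (2 * δ * x) = Real.exp (δ * x) * Real.exp (δ * x) := by
      rw [← Real.exp_add]; ring_nf
    simp only [this, Real.exp_neg]
    have h0 : (Real.exp (δ * x) : ℂ) ≠ 0 := by exact_mod_cast (Real.exp_pos _).ne'
    push_cast at h0 ⊢
    field_simp

/-- Expanding $e^{i\eta x}$ in its power series gives terms that are multiples of moments at
frequency $\tau$, all zero. The series is dominated by $x^je^{\delta x}|G|$; half of the exponential
decay absorbs $x^j$. All moments are carried along so that the step can be iterated. -/
theorem integral_pow_mul_cexp_eq_zero_step {δ η : ℝ} (hδ : 0 < δ) (hη : |η| ≤ δ) {G : ℝ → ℂ}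
    (hG : IntegrableOn (fun x => ((Real.exp (2 * δ * x) : ℝ) : ℂ) * G x) (Ioi 0)) {τ : ℝ}
    (h : ∀ j : ℕ, ∫ x in Ioi (0 : ℝ), (x : ℂ) ^ j * Complex.exp (τ * x * Complex.I) * G x = 0) (j : ℕ) :
    ∫ x in Ioi (0 : ℝ), (x : ℂ) ^ j * Complex.exp ((τ + η : ℝ) * x * Complex.I) * G x = 0 := by
  have hGm : AEStronglyMeasurable G (volume.restrict (Ioi 0)) := by
    have := integrableOn_pow_mul_exp_mul hδ hG 0
    have hm : AEStronglyMeasurable (fun x : ℝ => ((Real.exp (-(δ * x)) : ℝ) : ℂ))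
      (volume.restrict (Ioi 0)) := (by fun_prop : Continuous _).aestronglyMeasurable
    refine (hm.mul this.aestronglyMeasurable).congr (ae_of_all _ fun x => ?_)
    have h0 : (Real.exp (δ * x) : ℂ) ≠ 0 := by exact_mod_cast (Real.exp_pos _).ne'
    simp only [Pi.mul_apply, Real.exp_neg]
    push_cast at h0 ⊢
    field_simp
  have key := hasSum_integral_of_dominated_convergence
    (μ := volume.restrict (Ioi (0 : ℝ)))
    (F := fun (i : ℕ) (x : ℝ) => (x : ℂ) ^ j * Complex.exp (τ * x * Complex.I) * G x *
      ((η * x * Complex.I) ^ i / i.factorial))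
    (f := fun x : ℝ => (x : ℂ) ^ j * Complex.exp ((τ + η : ℝ) * x * Complex.I) * G x)
    (fun i x => (x ^ j * ‖G x‖) * ((δ * x) ^ i / i.factorial)) (fun i => ?_) (fun i => ?_) ?_ ?_ ?_
  · refine key.unique ?_
    convert hasSum_zero with i
    have : ∀ x : ℝ, (x : ℂ) ^ j * Complex.exp (τ * x * Complex.I) * G x *
      ((η * x * Complex.I) ^ i / i.factorial) = ((η * Complex.I) ^ i / i.factorial) *
        ((x : ℂ) ^ (j + i) * Complex.exp (τ * x * Complex.I) * G x) := by
      intro x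
      rw [pow_add, mul_right_comm (η : ℂ), mul_pow _ (x : ℂ)]
      ring
    simp_rw [this]
    rw [integral_const_mul, h, mul_zero]
  · refine AEStronglyMeasurable.mul (AEStronglyMeasurable.mul ?_ hGm) ?_
    · exact (by fun_prop : Continuous _).aestronglyMeasurable
    · exact (by fun_prop : Continuous _).aestronglyMeasurable
  · filter_upwards [ae_restrict_mem measurableSet_Ioi] with x (hx : 0 < x)
    have h1 : ‖Complex.exp (τ * x * Complex.I)‖ = 1 := by
      rw [← Complex.ofReal_mul, Complex.norm_exp_ofReal_mul_I]
    simp only [norm_mul, norm_div, norm_pow, h1, Complex.norm_real, Complex.norm_I,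
      Real.norm_eq_abs, abs_of_pos hx, mul_one, Complex.norm_natCast]
    gcongr
  · refine ae_of_all _ fun x => Summable.mul_left _ ?_
    exact Real.summable_pow_div_factorial _
  · have h1 := (integrableOn_pow_mul_exp_mul hδ hG j).norm
    refine h1.congr ?_
    filter_upwards [ae_restrict_mem measurableSet_Ioi] with x (hx : 0 < x)
    rw [tsum_mul_left, norm_mul, Complex.norm_real, Real.norm_of_nonneg (by positivity)]
    have := (NormedSpace.expSeries_div_hasSum_exp (δ * x)).tsum_eq
    rw [← Real.exp_eq_exp_ℝ] at this
    rw [this]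
    ring
  · refine ae_of_all _ fun x => ?_
    have := (NormedSpace.expSeries_div_hasSum_exp (η * x * Complex.I : ℂ)).mul_left
      ((x : ℂ) ^ j * Complex.exp (τ * x * Complex.I) * G x)
    rw [← Complex.exp_eq_exp_ℂ] at this
    have e : Complex.exp ((τ + η : ℝ) * x * Complex.I) =
        Complex.exp (τ * x * Complex.I) * Complex.exp (η * x * Complex.I) := by
      rw [← Complex.exp_add]
      push_cast
      ring_nf
    have e' : (x : ℂ) ^ j * Complex.exp ((τ + η : ℝ) * x * Complex.I) * G x =
        (x : ℂ) ^ j * Complex.exp (τ * x * Complex.I) * G x * Complex.exp (η * x * Complex.I) := by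
      rw [e]
      ring
    rw [e']
    exact this

/-- The power series in the frequency is controlled only for $|\eta|\le\delta$, so $\tau$ is reached
from $0$ in $m$ steps of length $|\tau|/m\le\delta$. -/
theorem integral_cexp_eq_zero_of_moments {δ : ℝ} (hδ : 0 < δ) {G : ℝ → ℂ}
    (hG : IntegrableOn (fun x => ((Real.exp (2 * δ * x) : ℝ) : ℂ) * G x) (Ioi 0))
    (h : ∀ j : ℕ, ∫ x in Ioi (0 : ℝ), (x : ℂ) ^ j * G x = 0) (τ : ℝ) :
    ∫ x in Ioi (0 : ℝ), Complex.exp (τ * x * Complex.I) * G x = 0 := by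
  obtain ⟨m, hm⟩ := exists_nat_gt (|τ| / δ)
  have hm0 : (0 : ℝ) < m := lt_of_le_of_lt (by positivity) hm
  have hη : |τ / m| ≤ δ := by
    rw [abs_div, abs_of_pos hm0, div_le_iff₀ hm0]
    rw [div_lt_iff₀ hδ] at hm
    linarith
  have key : ∀ n : ℕ, ∀ j : ℕ,
      ∫ x in Ioi (0 : ℝ), (x : ℂ) ^ j * Complex.exp ((n * (τ / m) : ℝ) * x * Complex.I) * G x = 0 := by
    intro n
    induction n with
    | zero => simpa using h
    | succ n ih =>
      intro j
      have := integral_pow_mul_cexp_eq_zero_step hδ hη hG ih j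
      rw [← this]
      congr! 7
      push_cast
      ring
  have := key m 0
  rw [mul_div_cancel₀ _ hm0.ne'] at this
  simpa using this

/-- Every test function is the Fourier transform of a Schwartz function; moving the transform onto
$G$ makes the pairing vanish. -/
theorem ae_eq_zero_of_fourier_eq_zero {G : ℝ → ℂ} (hG : Integrable G)
    (h : ∀ w, FourierTransform.fourier G w = 0) : ∀ᵐ x, G x = 0 := by
  refine ae_eq_zero_of_integral_contDiff_smul_eq_zero hG.locallyIntegrable fun g hg hgs => ?_
  let Φ : SchwartzMap ℝ ℂ := (hgs.comp_left (g := fun x : ℝ => (x : ℂ)) (by simp)).toSchwartzMap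
    (Complex.ofRealCLM.contDiff.comp hg)
  let Ψ : SchwartzMap ℝ ℂ := FourierTransformInv.fourierInv Φ
  have h1 : FourierTransform.fourier Ψ = Φ := FourierTransform.fourier_fourierInv_eq Φ
  have h2 := VectorFourier.integral_fourierIntegral_smul_eq_flip (L := innerₗ ℝ)
    (μ := volume) (ν := volume) (f := Ψ) (g := G) Real.continuous_fourierChar
    continuous_inner Ψ.integrable hG
  have h3 : ∀ w, VectorFourier.fourierIntegral Real.fourierChar volume (innerₗ ℝ) Ψ w = g w := by
    intro w
    have : FourierTransform.fourier Ψ w = g w := by rw [h1]; rfl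
    rw [← this]
    rfl
  have h4 : ∀ w, VectorFourier.fourierIntegral Real.fourierChar volume (innerₗ ℝ).flip G w = 0 := by
    intro w
    rw [flip_innerₗ]
    exact h w
  simp_rw [h3, h4] at h2
  simpa using h2

theorem ae_eq_zero_of_moments_eq_zero {δ : ℝ} (hδ : 0 < δ) {G : ℝ → ℂ}
    (hG : IntegrableOn (fun x => ((Real.exp (2 * δ * x) : ℝ) : ℂ) * G x) (Ioi 0))
    (h : ∀ j : ℕ, ∫ x in Ioi (0 : ℝ), (x : ℂ) ^ j * G x = 0) :
    ∀ᵐ x ∂(volume.restrict (Ioi (0 : ℝ))), G x = 0 := by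
  have hGi : IntegrableOn G (Ioi 0) := by
    refine (hG.bdd_mul (c := 1) (f := fun x : ℝ => ((Real.exp (-(2 * δ * x)) : ℝ) : ℂ))
      (by fun_prop : Continuous _).aestronglyMeasurable ?_).congr (ae_of_all _ fun x => ?_)
    · filter_upwards [ae_restrict_mem measurableSet_Ioi] with x (hx : 0 < x)
      rw [Complex.norm_real, Real.norm_of_nonneg (by positivity), Real.exp_le_one_iff]
      have : 0 < 2 * δ * x := by positivity
      linarith
    · simp only
      rw [← mul_assoc, ← Complex.ofReal_mul, ← Real.exp_add]
      simp
  have := ae_eq_zero_of_fourier_eq_zero ((integrable_indicator_iff measurableSet_Ioi).2 hGi) ?_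
  · rw [ae_restrict_iff' measurableSet_Ioi]
    filter_upwards [this] with x hx hx0
    rwa [indicator_of_mem hx0] at hx
  · intro w
    rw [Real.fourier_real_eq_integral_exp_smul]
    have h1 : ∀ v : ℝ, Complex.exp (↑(-2 * Real.pi * v * w) * Complex.I) • (Ioi 0).indicator G v =
        (Ioi 0).indicator (fun v : ℝ =>
          Complex.exp ((-2 * Real.pi * w : ℝ) * v * Complex.I) * G v) v := by
      intro v
      by_cases hv : v ∈ Ioi (0 : ℝ)
      · rw [indicator_of_mem hv, indicator_of_mem hv, smul_eq_mul]
        congr 3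
        push_cast
        ring
      · rw [indicator_of_notMem hv, indicator_of_notMem hv, smul_zero]
    simp_rw [h1]
    rw [integral_indicator measurableSet_Ioi]
    exact integral_cexp_eq_zero_of_moments hδ hG h _

/-! ### Laguerre functions: orthogonality, completeness, Parseval. -/

/-- The linear map `p ↦ e^{-λ x} p` into `L²_{ω^a}(ℝ⁺)`, for `a > -1` and `λ > 0`. -/
noncomputable def temperLp {a lam : ℝ} (ha : -1 < a) (hl : 0 < lam) :
    Polynomial ℂ →ₗ[ℂ] Lp ℂ 2 (weightMeasure a) where
  toFun p := (memLp_temper_eval ha hl p).toLp _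
  map_add' p q := by
    rw [← MemLp.toLp_add]
    congr 1
    ext x
    simp [temper, mul_add]
  map_smul' c p := by
    rw [RingHom.id_apply, ← MemLp.toLp_const_smul]
    congr 1
    ext x
    simp [temper]
    ring

theorem coeFn_temperLp {a lam : ℝ} (ha : -1 < a) (hl : 0 < lam) (p : Polynomial ℂ) :
    temperLp ha hl p =ᵐ[weightMeasure a] temper lam (fun x => p.eval (x : ℂ)) :=
  (memLp_temper_eval ha hl p).coeFn_toLp

theorem inner_temperLp_X_pow {a lam : ℝ} (ha : -1 < a) (hl : 0 < lam) (j : ℕ)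
    (h : Lp ℂ 2 (weightMeasure a)) :
    inner ℂ (temperLp ha hl (Polynomial.X ^ j)) h =
      ∫ x in Ioi (0 : ℝ), ((x ^ (a + j) : ℝ) : ℂ) * temper lam h x := by
  have h1 := coeFn_temperLp ha hl (Polynomial.X ^ j)
  rw [L2.inner_def, integral_congr_ae (g := fun x =>
    inner ℂ (temper lam (fun x => (Polynomial.X ^ j : Polynomial ℂ).eval (x : ℂ)) x) (h x))
    (h1.mono fun x hx => by simp only [hx]), integral_weightMeasure]
  refine setIntegral_congr_fun measurableSet_Ioi fun x (hx : 0 < x) => ?_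
  simp only [temper, Polynomial.eval_pow, Polynomial.eval_X, RCLike.inner_apply, map_mul, map_pow,
    Complex.conj_ofReal]
  rw [Real.rpow_add hx, Real.rpow_natCast]
  push_cast
  ring

theorem integral_rpow_mul_exp {c m : ℝ} (hc : 0 < c) (hm : 0 < m) :
    ∫ x in Ioi (0 : ℝ), x ^ (c - 1) * Real.exp (-(m * x)) = m ^ (-c) * Real.Gamma c := by
  rw [Real.integral_rpow_mul_exp_neg_mul_Ioi hc hm, one_div, Real.inv_rpow hm.le,
    Real.rpow_neg hm.le]

theorem inner_temperLp_X_pow_X_pow {a lam : ℝ} (ha : -1 < a) (hl : 0 < lam) (i j : ℕ) :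
    inner ℂ (temperLp ha hl (Polynomial.X ^ i)) (temperLp ha hl (Polynomial.X ^ j)) =
      (((2 * lam) ^ (-(a + 1 + i + j)) * Real.Gamma (a + 1 + i + j) : ℝ) : ℂ) := by
  have h0 : 0 < a + 1 + i + j := by
    have := i.cast_nonneg (α := ℝ)
    have := j.cast_nonneg (α := ℝ)
    linarith
  rw [inner_temperLp_X_pow, ← integral_rpow_mul_exp h0 (by positivity), ← integral_complex_ofReal]
  have h1 := coeFn_temperLp ha hl (Polynomial.X ^ j)
  rw [EventuallyEq, ae_weightMeasure] at h1
  refine integral_congr_ae ?_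
  filter_upwards [h1, ae_restrict_mem measurableSet_Ioi] with x hx (hx0 : 0 < x)
  have e1 : Real.exp (-(2 * lam * x)) = Real.exp (-(lam * x)) * Real.exp (-(lam * x)) := by
    rw [← Real.exp_add]; ring_nf
  have e2 : a + 1 + i + j - 1 = a + i + j := by ring
  rw [e1, e2, Real.rpow_add hx0 _ (j : ℝ), Real.rpow_natCast]
  simp only [temper] at hx ⊢
  rw [hx]
  simp only [Polynomial.eval_pow, Polynomial.eval_X]
  push_cast
  ring

theorem Gamma_add_natCast {x : ℝ} (hx : 0 < x) (j : ℕ) :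
    Real.Gamma (x + j) = (ascPochhammer ℝ j).eval x * Real.Gamma x := by
  induction j with
  | zero => simp
  | succ j ih =>
    have : 0 < x + j := by positivity
    rw [ascPochhammer_succ_eval, Nat.cast_succ, ← add_assoc, Real.Gamma_add_one this.ne', ih]
    ring

/-- Up to sign the sum is the $n$-th forward difference of $P$, which sees only the coefficient of
degree $n$. -/
theorem sum_neg_one_pow_choose_mul_eval {n : ℕ} {P : Polynomial ℝ} (hP : P.natDegree ≤ n) (y : ℝ) :
    ∑ i ∈ Finset.range (n + 1), (-1 : ℝ) ^ i * n.choose i * P.eval (y + i) =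
      (-1) ^ n * (P.coeff n * n.factorial) := by
  have h := fwdDiff_iter_eq_sum_shift (1 : ℝ) P.eval n y
  have h2 : ((fwdDiff (1 : ℝ))^[n] P.eval) y = P.coeff n * n.factorial := by
    rcases hP.lt_or_eq with h | rfl
    · rw [Polynomial.fwdDiff_iter_eq_zero_of_degree_lt h, Polynomial.coeff_eq_zero_of_natDegree_lt h]
      simp
    · rw [P.fwdDiff_iter_degree_eq_factorial]
      simp
  rw [← h2, h, Finset.mul_sum]
  refine Finset.sum_congr rfl fun i hi => ?_
  have hi' : i ≤ n := Nat.lt_succ_iff.1 (Finset.mem_range.1 hi)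
  obtain ⟨d, rfl⟩ := Nat.exists_eq_add_of_le hi'
  have : ((-1 : ℝ) ^ d) * (-1) ^ d = 1 := by rw [← mul_pow]; simp
  simp only [Nat.add_sub_cancel_left, nsmul_eq_mul, mul_one, zsmul_eq_mul]
  push_cast
  rw [pow_add]
  linear_combination (-(-1 : ℝ) ^ i * (i + d).choose i * P.eval (y + i)) * this

/-- The coefficients of `n! / Γ(n + a + 1) L_n^{(a)}(2 λ x)`, with `L_n^{(a)}` the generalized
Laguerre polynomial. -/
noncomputable def laguerreCoeff (a lam : ℝ) (n i : ℕ) : ℝ :=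
  (-1) ^ i * n.choose i * (2 * lam) ^ i / Real.Gamma (a + 1 + i)

/-- The polynomial `n! / Γ(n + a + 1) L_n^{(a)}(2 λ x)`. -/
noncomputable def laguerrePoly (a lam : ℝ) (n : ℕ) : Polynomial ℂ :=
  ∑ i ∈ Finset.range (n + 1), (laguerreCoeff a lam n i : ℂ) • Polynomial.X ^ i

theorem laguerrePoly_coeff (a lam : ℝ) (n i : ℕ) :
    (laguerrePoly a lam n).coeff i = laguerreCoeff a lam n i := by
  simp only [laguerrePoly, Polynomial.finsetSum_coeff, Polynomial.coeff_smul,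
    Polynomial.coeff_X_pow, smul_eq_mul, mul_ite, mul_one, mul_zero, Finset.sum_ite_eq,
    Finset.mem_range]
  split_ifs with h
  · rfl
  · rw [laguerreCoeff, Nat.choose_eq_zero_of_lt (by lia)]
    simp

theorem laguerrePoly_natDegree_le (a lam : ℝ) (n : ℕ) : (laguerrePoly a lam n).natDegree ≤ n := by
  rw [Polynomial.natDegree_le_iff_coeff_eq_zero]
  intro i hi
  rw [laguerrePoly_coeff, laguerreCoeff, Nat.choose_eq_zero_of_lt (by lia)]
  simp

theorem inner_laguerrePoly {a lam : ℝ} (ha : -1 < a) (hl : 0 < lam) (n : ℕ)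
    (h : Lp ℂ 2 (weightMeasure a)) :
    inner ℂ (temperLp ha hl (laguerrePoly a lam n)) h =
      ∑ i ∈ Finset.range (n + 1), (laguerreCoeff a lam n i : ℂ) *
        inner ℂ (temperLp ha hl (Polynomial.X ^ i)) h := by
  rw [laguerrePoly, map_sum, sum_inner]
  refine Finset.sum_congr rfl fun i _ => ?_
  rw [map_smul, inner_smul_left, Complex.conj_ofReal]

/-- The quotient $\Gamma(a+1+i+j)/\Gamma(a+1+i)$ is the rising factorial of degree $j$ at $a+1+i$, a
monic polynomial in $i$. The inner product is thus an $n$-th difference of a polynomial of degree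
$j\le n$. -/
theorem inner_laguerrePoly_X_pow {a lam : ℝ} (ha : -1 < a) (hl : 0 < lam) {n j : ℕ} (hj : j ≤ n) :
    inner ℂ (temperLp ha hl (laguerrePoly a lam n)) (temperLp ha hl (Polynomial.X ^ j)) =
      (((2 * lam) ^ (-(a + 1 + j)) * ((-1) ^ n * (if j = n then (n.factorial : ℝ) else 0)) : ℝ) : ℂ)
      := by
  have hdeg : (ascPochhammer ℝ j).natDegree ≤ n := by rwa [ascPochhammer_natDegree]
  have h := sum_neg_one_pow_choose_mul_eval hdeg (a + 1)
  have hc : (ascPochhammer ℝ j).coeff n = if j = n then 1 else 0 := by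
    split_ifs with hjn
    · subst hjn
      have := (monic_ascPochhammer (S := ℝ) j).coeff_natDegree
      rwa [ascPochhammer_natDegree] at this
    · exact Polynomial.coeff_eq_zero_of_natDegree_lt
        (by rw [ascPochhammer_natDegree]; exact lt_of_le_of_ne hj hjn)
  rw [hc, ite_mul, one_mul, zero_mul] at h
  rw [inner_laguerrePoly, ← h, Finset.mul_sum, Complex.ofReal_sum]
  refine Finset.sum_congr rfl fun i _ => ?_
  have hp : 0 < a + 1 + i := by
    have := i.cast_nonneg (α := ℝ)
    linarith
  rw [inner_temperLp_X_pow_X_pow, ← Complex.ofReal_mul, Gamma_add_natCast hp, laguerreCoeff]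
  congr 1
  have h2 : (2 * lam) ^ (-(a + 1 + j)) = (2 * lam) ^ i * (2 * lam) ^ (-(a + 1 + i + j)) := by
    rw [← Real.rpow_natCast, ← Real.rpow_add (by positivity)]
    ring_nf
  rw [h2]
  have := (Real.Gamma_pos_of_pos hp).ne'
  field_simp

/-- Orthogonality to the monomials of degree below $n$ leaves only the top coefficient. -/
theorem inner_laguerrePoly_temperLp {a lam : ℝ} (ha : -1 < a) (hl : 0 < lam) {n : ℕ}
    {p : Polynomial ℂ} (hp : p.natDegree ≤ n) :
    inner ℂ (temperLp ha hl (laguerrePoly a lam n)) (temperLp ha hl p) =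
      p.coeff n * (((2 * lam) ^ (-(a + 1 + n)) * ((-1) ^ n * n.factorial) : ℝ) : ℂ) := by
  conv_lhs => rw [p.as_sum_range' (n + 1) (by lia)]
  rw [map_sum, inner_sum, Finset.sum_range_succ, Finset.sum_eq_zero, zero_add]
  · rw [← Polynomial.C_mul_X_pow_eq_monomial, ← Polynomial.smul_eq_C_mul, map_smul, inner_smul_right,
      inner_laguerrePoly_X_pow ha hl le_rfl, if_pos rfl]
  · intro j hj
    have hj' := Finset.mem_range.1 hj
    rw [← Polynomial.C_mul_X_pow_eq_monomial, ← Polynomial.smul_eq_C_mul, map_smul, inner_smul_right,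
      inner_laguerrePoly_X_pow ha hl hj'.le, if_neg hj'.ne]
    simp

/-- The inverse square of the norm of `temperLp _ _ (laguerrePoly a lam n)`. -/
noncomputable def laguerreWeight (a lam : ℝ) (n : ℕ) : ℝ :=
  (2 * lam) ^ (a + 1) * Real.Gamma (a + 1 + n) / n.factorial

theorem laguerreWeight_pos {a lam : ℝ} (ha : -1 < a) (hl : 0 < lam) (n : ℕ) :
    0 < laguerreWeight a lam n := by
  have : 0 < a + 1 + n := by
    have := n.cast_nonneg (α := ℝ)
    linarith
  have := Real.Gamma_pos_of_pos this
  unfold laguerreWeight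
  positivity

theorem inner_laguerrePoly_self {a lam : ℝ} (ha : -1 < a) (hl : 0 < lam) (n : ℕ) :
    inner ℂ (temperLp ha hl (laguerrePoly a lam n)) (temperLp ha hl (laguerrePoly a lam n)) =
      (((laguerreWeight a lam n)⁻¹ : ℝ) : ℂ) := by
  rw [inner_laguerrePoly_temperLp ha hl (laguerrePoly_natDegree_le a lam n), laguerrePoly_coeff,
    ← Complex.ofReal_mul, laguerreCoeff, laguerreWeight]
  congr 1
  have h2 : (2 * lam) ^ (-(a + 1 + n)) = ((2 * lam) ^ n)⁻¹ * ((2 * lam) ^ (a + 1))⁻¹ := by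
    rw [← Real.rpow_natCast, ← Real.rpow_neg (by positivity), ← Real.rpow_neg (by positivity),
      ← Real.rpow_add (by positivity)]
    ring_nf
  have : 0 < a + 1 + n := by
    have := n.cast_nonneg (α := ℝ)
    linarith
  have := (Real.Gamma_pos_of_pos this).ne'
  have h3 : ((-1 : ℝ) ^ n) * (-1) ^ n = 1 := by rw [← mul_pow]; simp
  rw [h2, Nat.choose_self]
  have h4 : (2 * lam) ^ (a + 1) ≠ 0 := (Real.rpow_pos_of_pos (by positivity) _).ne'
  field_simp
  rw [sq, h3]
  ring

theorem inner_laguerrePoly_of_ne {a lam : ℝ} (ha : -1 < a) (hl : 0 < lam) {n m : ℕ} (h : n ≠ m) :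
    inner ℂ (temperLp ha hl (laguerrePoly a lam n)) (temperLp ha hl (laguerrePoly a lam m)) = 0 := by
  wlog hnm : m < n generalizing n m
  · rw [← inner_conj_symm, this h.symm (by lia), map_zero]
  · have hm := laguerrePoly_natDegree_le a lam m
    rw [inner_laguerrePoly_temperLp ha hl (hm.trans hnm.le),
      Polynomial.coeff_eq_zero_of_natDegree_lt (hm.trans_lt hnm), zero_mul]

/-- The moments of $x^ae^{-\lambda x}h$ all vanish, and this function has exponential decay to
spare. -/
theorem eq_zero_of_inner_laguerrePoly_eq_zero {a lam : ℝ} (ha : -1 < a) (hl : 0 < lam)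
    {h : Lp ℂ 2 (weightMeasure a)}
    (h0 : ∀ n, inner ℂ (temperLp ha hl (laguerrePoly a lam n)) h = 0) : h = 0 := by
  -- Triangularity: the top coefficient of `laguerrePoly a lam n` is nonzero, so the $n$-th moment
  -- is determined by the lower ones.
  have h1 : ∀ n, inner ℂ (temperLp ha hl (Polynomial.X ^ n)) h = 0 := by
    intro n
    induction n using Nat.strong_induction_on with
    | _ n ih =>
      have := h0 n
      rw [inner_laguerrePoly, Finset.sum_range_succ, Finset.sum_eq_zero, zero_add] at this
      · refine (mul_eq_zero.1 this).resolve_left ?_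
        have hp : 0 < a + 1 + n := by
          have := n.cast_nonneg (α := ℝ)
          linarith
        have := (Real.Gamma_pos_of_pos hp).ne'
        rw [← ne_eq, Complex.ofReal_ne_zero, laguerreCoeff, Nat.choose_self]
        have : (-1 : ℝ) ^ n ≠ 0 := pow_ne_zero _ (by norm_num)
        positivity
      · intro i hi
        rw [ih i (Finset.mem_range.1 hi), mul_zero]
  -- With $\delta=\lambda/4$ the factor $e^{2\delta x}$ uses up half of $e^{-\lambda x}$, and the
  -- other half keeps the function integrable.
  have h2 := ae_eq_zero_of_moments_eq_zero (δ := lam / 4) (by positivity)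
    (G := fun x => ((x ^ a : ℝ) : ℂ) * temper lam h x) ?_ ?_
  · rw [Lp.eq_zero_iff_ae_eq_zero, EventuallyEq, ae_weightMeasure]
    filter_upwards [h2, ae_restrict_mem measurableSet_Ioi] with x hx (hx0 : 0 < x)
    have e1 : ((x ^ a : ℝ) : ℂ) ≠ 0 := by exact_mod_cast (Real.rpow_pos_of_pos hx0 a).ne'
    have e2 : ((Real.exp (-(lam * x)) : ℝ) : ℂ) ≠ 0 := by exact_mod_cast (Real.exp_pos _).ne'
    rw [temper] at hx
    exact (mul_eq_zero.1 ((mul_eq_zero.1 hx).resolve_left e1)).resolve_left e2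
  · refine (integrableOn_rpow_mul_temper ha (half_pos hl) (Lp.memLp h) 0).congr
      (ae_of_all _ fun x => ?_)
    have : Real.exp (-(lam / 2 * x)) = Real.exp (2 * (lam / 4) * x) * Real.exp (-(lam * x)) := by
      rw [← Real.exp_add]; ring_nf
    simp only [temper, this, Nat.cast_zero, add_zero]
    push_cast
    ring
  · intro j
    have := h1 j
    rw [inner_temperLp_X_pow] at this
    rw [← this]
    refine setIntegral_congr_fun measurableSet_Ioi fun x (hx : 0 < x) => ?_
    rw [Real.rpow_add hx, Real.rpow_natCast]
    push_cast
    ring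

/-- Parseval, stated for the unnormalized functions: their inner products are what a tempered
derivative preserves, and the dependence on $a$ is then isolated in the weight. -/
theorem hasSum_laguerreWeight_mul_norm_sq {a lam : ℝ} (ha : -1 < a) (hl : 0 < lam)
    (h : Lp ℂ 2 (weightMeasure a)) :
    HasSum (fun n => laguerreWeight a lam n *
      ‖(inner ℂ (temperLp ha hl (laguerrePoly a lam n)) h : ℂ)‖ ^ 2) (‖h‖ ^ 2) := by
  let e : ℕ → Lp ℂ 2 (weightMeasure a) := fun n =>
    ((√(laguerreWeight a lam n) : ℝ) : ℂ) • temperLp ha hl (laguerrePoly a lam n)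
  have he : ∀ n h, inner ℂ (e n) h = ((√(laguerreWeight a lam n) : ℝ) : ℂ) *
      inner ℂ (temperLp ha hl (laguerrePoly a lam n)) h := by
    intro n h
    simp only [e]
    rw [inner_smul_left, Complex.conj_ofReal]
  have hw : ∀ n, ((√(laguerreWeight a lam n) : ℝ) : ℂ) ≠ 0 := fun n => by
    exact_mod_cast (Real.sqrt_pos.2 (laguerreWeight_pos ha hl n)).ne'
  have ho : Orthonormal ℂ e := by
    rw [orthonormal_iff_ite]
    intro n m
    rw [he]
    simp only [e]
    rw [inner_smul_right]
    split_ifs with hnm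
    · subst hnm
      rw [inner_laguerrePoly_self, ← Complex.ofReal_mul, ← Complex.ofReal_mul, ← mul_assoc,
        Real.mul_self_sqrt (laguerreWeight_pos ha hl n).le,
        mul_inv_cancel₀ (laguerreWeight_pos ha hl n).ne', Complex.ofReal_one]
    · rw [inner_laguerrePoly_of_ne ha hl hnm, mul_zero, mul_zero]
  have hsp : (Submodule.span ℂ (Set.range e))ᗮ = ⊥ := by
    rw [Submodule.eq_bot_iff]
    intro h hh
    refine eq_zero_of_inner_laguerrePoly_eq_zero ha hl fun n => ?_
    have := Submodule.inner_right_of_mem_orthogonal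
      (Submodule.subset_span (Set.mem_range_self n)) hh
    rw [he] at this
    exact (mul_eq_zero.1 this).resolve_left (hw n)
  let b := HilbertBasis.mkOfOrthogonalEqBot ho hsp
  have hb : ∀ n, b n = e n := fun n => by simp [b]
  have := (b.hasSum_inner_mul_inner h h).mapL Complex.reCLM
  convert this using 1
  · ext n
    rw [hb, ← inner_conj_symm h, he, Complex.reCLM_apply, ← Complex.normSq_eq_conj_mul_self,
      Complex.ofReal_re, Complex.normSq_mul, Complex.normSq_ofReal,
      Real.mul_self_sqrt (laguerreWeight_pos ha hl n).le, Complex.normSq_eq_norm_sq]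
  · rw [Complex.reCLM_apply]
    exact (inner_self_eq_norm_sq (𝕜 := ℂ) h).symm

/-! ### Linearity and uniqueness of the weak fractional derivative. -/

theorem integrableOn_mul_of_tsupport_subset {φ : ℝ → ℝ} (hφ : Continuous φ)
    (hc : HasCompactSupport φ) (hs : tsupport φ ⊆ Ioi 0) {F : ℝ → ℂ}
    (hF : LocallyIntegrableOn F (Ioi 0)) :
    IntegrableOn (fun x => ((φ x : ℝ) : ℂ) * F x) (Ioi 0) := by
  have h1 := hF.integrableOn_compact_subset hs hc
  have hφ' : Continuous fun x => ((φ x : ℝ) : ℂ) := by fun_prop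
  have h2 := h1.continuousOn_mul hφ'.continuousOn hc
  refine (IntegrableOn.integrable_of_forall_notMem_eq_zero h2 fun x hx => ?_).integrableOn
  rw [image_eq_zero_of_notMem_tsupport hx]
  simp

theorem tsupport_iteratedDeriv_subset (φ : ℝ → ℝ) (k : ℕ) :
    tsupport (iteratedDeriv k φ) ⊆ tsupport φ := by
  induction k with
  | zero => simp
  | succ k ih => rw [iteratedDeriv_succ]; exact tsupport_deriv_subset.trans ih

theorem rightRLIntegral_congr {κ : ℝ} {f f' : ℝ → ℂ}
    (h : f =ᵐ[volume.restrict (Ioi (0 : ℝ))] f') {x : ℝ} (hx : 0 < x) :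
    rightRLIntegral κ f x = rightRLIntegral κ f' x := by
  rw [rightRLIntegral, rightRLIntegral]
  congr 1
  refine integral_congr_ae ?_
  filter_upwards [ae_restrict_of_ae_restrict_of_subset (Ioi_subset_Ioi hx.le) h] with y hy
  rw [rightRLKernel, rightRLKernel, hy]

theorem IsRightRLDeriv.congr {s : ℝ} {f f' g g' : ℝ → ℂ} (h : IsRightRLDeriv s f g)
    (hf : f =ᵐ[volume.restrict (Ioi (0 : ℝ))] f') (hg : g =ᵐ[volume.restrict (Ioi (0 : ℝ))] g') :
    IsRightRLDeriv s f' g' := by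
  obtain ⟨h1, h2, h3, h4⟩ := h
  have hI : EqOn (rightRLIntegral ((⌊s⌋₊ + 1 : ℕ) - s) f)
    (rightRLIntegral ((⌊s⌋₊ + 1 : ℕ) - s) f') (Ioi 0) := fun x hx => rightRLIntegral_congr hf hx
  refine ⟨?_, ?_, h3.congr hg, fun φ hφ hc hs => ?_⟩
  · filter_upwards [h1, ae_restrict_mem measurableSet_Ioi] with x hx (hx0 : 0 < x)
    refine hx.congr ?_
    filter_upwards [ae_restrict_of_ae_restrict_of_subset (Ioi_subset_Ioi hx0.le) hf] with y hy
    rw [rightRLKernel, rightRLKernel, hy]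
  · exact h2.congr ((ae_restrict_iff' measurableSet_Ioi).2 (ae_of_all _ hI))
  · have := h4 φ hφ hc hs
    rw [setIntegral_congr_fun measurableSet_Ioi (fun x hx => by rw [hI hx])] at this
    rw [this]
    refine integral_congr_ae ?_
    filter_upwards [hg] with x hx
    rw [hx]

theorem IsRightRLDeriv.sub {s : ℝ} {f f' g g' : ℝ → ℂ} (h : IsRightRLDeriv s f g)
    (h' : IsRightRLDeriv s f' g') :
    IsRightRLDeriv s (fun x => f x - f' x) (fun x => g x - g' x) := by
  obtain ⟨h1, h2, h3, h4⟩ := h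
  obtain ⟨h1', h2', h3', h4'⟩ := h'
  set κ : ℝ := (⌊s⌋₊ + 1 : ℕ) - s
  have hK : ∀ x y, rightRLKernel κ (fun x => f x - f' x) x y =
      rightRLKernel κ f x y - rightRLKernel κ f' x y := by
    intro x y
    simp only [rightRLKernel]
    ring
  have hI : (fun x => rightRLIntegral κ f x - rightRLIntegral κ f' x)
      =ᵐ[volume.restrict (Ioi (0 : ℝ))] rightRLIntegral κ (fun x => f x - f' x) := by
    filter_upwards [h1, h1'] with x hx hx'
    simp only [rightRLIntegral, hK]
    rw [integral_sub hx hx', mul_sub]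
  refine ⟨?_, (h2.sub h2').congr hI, h3.sub h3', fun φ hφ hc hs => ?_⟩
  · filter_upwards [h1, h1'] with x hx hx'
    exact (hx.sub hx').congr (ae_of_all _ fun y => (hK x y).symm)
  · have hφk : Continuous (iteratedDeriv (⌊s⌋₊ + 1) φ) :=
      hφ.continuous_iteratedDeriv _ (by exact_mod_cast le_top)
    have hts := tsupport_iteratedDeriv_subset φ (⌊s⌋₊ + 1)
    have hck : HasCompactSupport (iteratedDeriv (⌊s⌋₊ + 1) φ) :=
      hc.of_isClosed_subset (isClosed_tsupport _) hts
    have e1 := integral_sub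
      (integrableOn_mul_of_tsupport_subset hφk hck (hts.trans hs) h2)
      (integrableOn_mul_of_tsupport_subset hφk hck (hts.trans hs) h2')
    have e2 := integral_sub
      (integrableOn_mul_of_tsupport_subset hφ.continuous hc hs h3)
      (integrableOn_mul_of_tsupport_subset hφ.continuous hc hs h3')
    simp_rw [mul_sub]
    rw [e2, ← h4 φ hφ hc hs, ← h4' φ hφ hc hs, ← e1]
    refine integral_congr_ae ?_
    filter_upwards [hI] with x hx
    rw [← hx, mul_sub]

/-- By the fundamental lemma of the calculus of variations. It identifies the representative chosen
in `rightRLDeriv` with an explicit derivative. -/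
theorem IsRightRLDeriv.unique {s : ℝ} {f g g' : ℝ → ℂ} (h : IsRightRLDeriv s f g)
    (h' : IsRightRLDeriv s f g') : g =ᵐ[volume.restrict (Ioi (0 : ℝ))] g' := by
  have key := isOpen_Ioi.ae_eq_zero_of_integral_contDiff_smul_eq_zero (μ := volume)
    (h.2.2.1.sub h'.2.2.1) fun φ hφ hc hs => by
      have e2 := integral_sub
        (integrableOn_mul_of_tsupport_subset hφ.continuous hc hs h.2.2.1)
        (integrableOn_mul_of_tsupport_subset hφ.continuous hc hs h'.2.2.1)
      rw [← h.2.2.2 φ hφ hc hs, ← h'.2.2.2 φ hφ hc hs, sub_self] at e2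
      rw [← e2, ← setIntegral_eq_integral_of_forall_compl_eq_zero (s := Ioi (0 : ℝ))]
      · simp [mul_sub]
      · intro x hx
        rw [image_eq_zero_of_notMem_tsupport fun h => hx (hs h), zero_smul]
  rw [EventuallyEq, ae_restrict_iff' measurableSet_Ioi]
  filter_upwards [key] with x hx hx0
  exact sub_eq_zero.1 (hx hx0)

theorem HasRightTemperedDeriv.isRightRLDeriv {lam s : ℝ} {u : ℝ → ℂ}
    (h : HasRightTemperedDeriv lam s u) :
    IsRightRLDeriv s (temper lam u) (rightRLDeriv s (temper lam u)) := by
  have h' : ∃ g, IsRightRLDeriv s (temper lam u) g := h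
  rw [rightRLDeriv, dif_pos h']
  exact h'.choose_spec

/-! ### Fractional derivatives of polynomials times exponentials. -/

theorem integrableOn_Ioi_comp_add {F : ℝ → ℂ} {x : ℝ} :
    IntegrableOn (fun t => F (t + x)) (Ioi 0) ↔ IntegrableOn F (Ioi x) := by
  have h := (measurePreserving_add_right volume x).integrableOn_comp_preimage
    (measurableEmbedding_addRight x) (f := F) (s := Ioi x)
  rw [← h]
  simp [Function.comp_def]

theorem setIntegral_Ioi_comp_add (F : ℝ → ℂ) (x : ℝ) :
    ∫ t in Ioi 0, F (t + x) = ∫ y in Ioi x, F y := by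
  have h := (measurePreserving_add_right volume x).setIntegral_preimage_emb
    (measurableEmbedding_addRight x) F (Ioi x)
  rw [← h]
  simp

theorem temper_eval_add (μ : ℝ) (p : Polynomial ℂ) (t x : ℝ) :
    temper μ (fun x => p.eval (x : ℂ)) (t + x) =
      ∑ j ∈ Finset.range (p.natDegree + 1), ((t ^ j * Real.exp (-(μ * t)) : ℝ) : ℂ) *
        temper μ (fun x => (Polynomial.hasseDeriv j p).eval (x : ℂ)) x := by
  simp only [temper]
  rw [Complex.ofReal_add, ← Polynomial.taylor_eval, Polynomial.eval_eq_sum_range,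
    Polynomial.natDegree_taylor, Finset.mul_sum]
  refine Finset.sum_congr rfl fun j _ => ?_
  rw [Polynomial.taylor_coeff, mul_add, neg_add, Real.exp_add]
  push_cast
  ring

/-- After the substitution $y=t+x$, Taylor expansion of $p$ separates the variables: the
$t$-integrals are constants, and Hasse derivatives of $p$ remain. -/
theorem exists_rightRLIntegral_temper_eval {κ μ : ℝ} (hκ : 0 < κ) (hμ : 0 < μ)
    (p : Polynomial ℂ) : ∃ q : Polynomial ℂ, ∀ x,
      IntegrableOn (rightRLKernel κ (temper μ fun x => p.eval (x : ℂ)) x) (Ioi x) ∧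
      rightRLIntegral κ (temper μ fun x => p.eval (x : ℂ)) x =
        temper μ (fun x => q.eval (x : ℂ)) x := by
  let c : ℕ → ℂ := fun j => ∫ t in Ioi (0 : ℝ),
    ((t ^ (κ - 1) * (t ^ j * Real.exp (-(μ * t))) : ℝ) : ℂ)
  have hI : ∀ j : ℕ, IntegrableOn (fun t : ℝ =>
      ((t ^ (κ - 1) * (t ^ j * Real.exp (-(μ * t))) : ℝ) : ℂ)) (Ioi 0) := by
    intro j
    have h1 : -1 < κ - 1 + j := by
      have := j.cast_nonneg (α := ℝ)
      linarith
    have h2 : IntegrableOn (fun t : ℝ => ((t ^ (κ - 1 + j) * Real.exp (-(μ * t)) : ℝ) : ℂ)) (Ioi 0) :=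
      (integrableOn_rpow_mul_exp h1 hμ).ofReal
    refine h2.congr_fun (fun t (ht : 0 < t) => ?_) measurableSet_Ioi
    beta_reduce
    rw [Real.rpow_add ht, Real.rpow_natCast, mul_assoc]
  have hk : ∀ x t : ℝ, rightRLKernel κ (temper μ fun x => p.eval (x : ℂ)) x (t + x) =
      ∑ j ∈ Finset.range (p.natDegree + 1),
        ((t ^ (κ - 1) * (t ^ j * Real.exp (-(μ * t))) : ℝ) : ℂ) *
          temper μ (fun x => (Polynomial.hasseDeriv j p).eval (x : ℂ)) x := by
    intro x t
    rw [rightRLKernel, temper_eval_add, add_sub_cancel_right, Finset.mul_sum]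
    refine Finset.sum_congr rfl fun j _ => ?_
    push_cast
    ring
  refine ⟨∑ j ∈ Finset.range (p.natDegree + 1), (((1 / Real.Gamma κ : ℝ) : ℂ) * c j) •
    Polynomial.hasseDeriv j p, fun x => ⟨?_, ?_⟩⟩
  · rw [← integrableOn_Ioi_comp_add]
    simp_rw [hk]
    exact integrable_finsetSum _ fun j _ => (hI j).mul_const _
  · rw [rightRLIntegral, ← setIntegral_Ioi_comp_add]
    simp_rw [hk]
    rw [integral_finsetSum _ fun j _ => (hI j).mul_const _]
    simp_rw [integral_mul_const]
    simp only [temper, Polynomial.eval_finsetSum, Polynomial.eval_smul, smul_eq_mul, Finset.mul_sum]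
    refine Finset.sum_congr rfl fun j _ => ?_
    simp only [c]
    ring

theorem continuous_temper_eval (μ : ℝ) (p : Polynomial ℂ) :
    Continuous (temper μ fun x => p.eval (x : ℂ)) := by
  unfold temper
  fun_prop

theorem hasDerivAt_temper_eval (μ : ℝ) (p : Polynomial ℂ) (x : ℝ) :
    HasDerivAt (temper μ fun x => p.eval (x : ℂ))
      (temper μ (fun x => (p.derivative - Polynomial.C (μ : ℂ) * p).eval (x : ℂ)) x) x := by
  have h1 : HasDerivAt (fun x : ℝ => Real.exp (-(μ * x))) (Real.exp (-(μ * x)) * -μ) x := by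
    have := ((hasDerivAt_id x).const_mul μ).neg.exp
    simpa using this
  have h2 := (p.hasDerivAt (x : ℂ)).comp_ofReal
  have := h1.ofReal_comp.mul h2
  unfold temper
  refine this.congr_deriv ?_
  simp only [Polynomial.eval_sub, Polynomial.eval_mul, Polynomial.eval_C]
  push_cast
  ring

/-- Each integration by parts sends $p$ to $-(p'-\mu p)$, again a polynomial, with no boundary
terms. -/
theorem exists_iteratedDeriv_mul_temper_eval (μ : ℝ) (k : ℕ) (p : Polynomial ℂ) :
    ∃ q : Polynomial ℂ, ∀ φ : ℝ → ℝ, ContDiff ℝ (⊤ : ℕ∞) φ → HasCompactSupport φ →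
      ∫ x, ((iteratedDeriv k φ x : ℝ) : ℂ) * temper μ (fun x => p.eval (x : ℂ)) x =
        ∫ x, ((φ x : ℝ) : ℂ) * temper μ (fun x => q.eval (x : ℂ)) x := by
  induction k with
  | zero => exact ⟨p, fun φ _ _ => by simp⟩
  | succ k ih =>
    obtain ⟨q, hq⟩ := ih
    refine ⟨-(q.derivative - Polynomial.C (μ : ℂ) * q), fun φ hφ hc => ?_⟩
    have hd : ContDiff ℝ (⊤ : ℕ∞) (deriv φ) := (contDiff_infty_iff_deriv.1 hφ).2
    rw [iteratedDeriv_succ', hq _ hd hc.deriv]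
    have hcs : ∀ (ψ : ℝ → ℝ), Continuous ψ → HasCompactSupport ψ → ∀ (p : Polynomial ℂ),
        Integrable (fun x => temper μ (fun x => p.eval (x : ℂ)) x * ((ψ x : ℝ) : ℂ)) := by
      intro ψ h1 h2 p
      refine ((continuous_temper_eval μ p).mul
        (by fun_prop : Continuous fun x => ((ψ x : ℝ) : ℂ))).integrable_of_hasCompactSupport ?_
      exact (h2.comp_left (g := fun x : ℝ => (x : ℂ)) (by simp)).mul_left
    have hdφ : ∀ x, HasDerivAt (fun x => ((φ x : ℝ) : ℂ)) ((deriv φ x : ℝ) : ℂ) x := fun x =>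
      ((hφ.differentiable (by simp)) x).hasDerivAt.ofReal_comp
    have := integral_mul_deriv_eq_deriv_mul_of_integrable
      (fun x _ => hasDerivAt_temper_eval μ q x) (fun x _ => hdφ x)
      (hcs _ hd.continuous hc.deriv q) (hcs _ hφ.continuous hc _) (hcs _ hφ.continuous hc q)
    simp_rw [mul_comm (((deriv φ _ : ℝ) : ℂ))]
    rw [this, ← integral_neg]
    refine integral_congr_ae (ae_of_all _ fun x => ?_)
    simp only [temper, Polynomial.eval_neg]
    ring

theorem exists_isRightRLDeriv_temper_eval {s μ : ℝ} (hμ : 0 < μ) (p : Polynomial ℂ) :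
    ∃ q : Polynomial ℂ, IsRightRLDeriv s (temper μ fun x => p.eval (x : ℂ))
      (temper μ fun x => q.eval (x : ℂ)) := by
  have hκ : (0 : ℝ) < (⌊s⌋₊ + 1 : ℕ) - s := by
    rw [sub_pos]; exact_mod_cast Nat.lt_floor_add_one s
  obtain ⟨q, hq⟩ := exists_rightRLIntegral_temper_eval hκ hμ p
  obtain ⟨q', hq'⟩ := exists_iteratedDeriv_mul_temper_eval μ (⌊s⌋₊ + 1) q
  refine ⟨q', ae_of_all _ fun x => (hq x).1, ?_,
    (continuous_temper_eval μ q').locallyIntegrable.locallyIntegrableOn _, fun φ hφ hc hs => ?_⟩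
  · rw [funext fun x => (hq x).2]
    exact (continuous_temper_eval μ q).locallyIntegrable.locallyIntegrableOn _
  · simp_rw [(hq _).2]
    rw [setIntegral_eq_integral_of_forall_compl_eq_zero,
      setIntegral_eq_integral_of_forall_compl_eq_zero, hq' φ hφ hc]
    · intro x hx
      rw [image_eq_zero_of_notMem_tsupport fun h => hx (hs h)]
      simp
    · intro x hx
      rw [image_eq_zero_of_notMem_tsupport fun h =>
        hx (hs (tsupport_iteratedDeriv_subset _ _ h))]
      simp

/-! ### Laguerre coefficients of tempered derivatives and the error estimate. -/

theorem weightNorm_eq_norm_toLp {a : ℝ} {f : ℝ → ℂ} (hf : MemLp f 2 (weightMeasure a)) :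
    weightNorm a f = ‖hf.toLp f‖ := (Lp.norm_toLp f hf).symm

theorem temper_rightTemperedDeriv (lam s : ℝ) (u : ℝ → ℂ) :
    temper lam (rightTemperedDeriv lam s u) = rightRLDeriv s (temper lam u) := by
  ext x
  rw [temper, rightTemperedDeriv, ← mul_assoc, ← Complex.ofReal_mul, ← Real.exp_add]
  simp

theorem temper_congr {a lam : ℝ} {u v : ℝ → ℂ} (h : u =ᵐ[weightMeasure a] v) :
    temper lam u =ᵐ[volume.restrict (Ioi (0 : ℝ))] temper lam v := by
  rw [EventuallyEq, ← ae_weightMeasure a]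
  filter_upwards [h] with x hx
  rw [temper, temper, hx]

/-- The identity holds term by term. The factor $1/\Gamma(\nu+s+1+i)$ in the coefficient is exactly
the normalization of the moment in `IsRightRLDeriv.moment` with $a=\nu+1+i$, and the remaining
factors do not involve $s$. -/
theorem inner_laguerrePoly_rightTemperedDeriv {nu lam s : ℝ} (hnu : 0 < nu) (hl : 0 < lam)
    (hs : 0 ≤ s) {v : Lp ℂ 2 (weightMeasure nu)} (hv : TemperedDerivMemL2 lam s (nu + s) v)
    (n : ℕ) :
    inner ℂ (temperLp (by linarith : -1 < nu + s) hl (laguerrePoly (nu + s) lam n))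
        (hv.2.toLp (rightTemperedDeriv lam s v)) =
      inner ℂ (temperLp (by linarith : -1 < nu) hl (laguerrePoly nu lam n)) v := by
  rw [inner_laguerrePoly, inner_laguerrePoly]
  refine Finset.sum_congr rfl fun i _ => ?_
  rw [inner_temperLp_X_pow, inner_temperLp_X_pow]
  have hi : (0 : ℝ) ≤ i := i.cast_nonneg
  have h1 := temper_congr (lam := lam) hv.2.coeFn_toLp
  rw [temper_rightTemperedDeriv] at h1
  have hf := integrableOn_rpow_mul_temper (by linarith : -1 < nu) hl (Lp.memLp v) i
  have hg := integrableOn_rpow_mul_temper (by linarith : -1 < nu + s) hl hv.2 i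
  rw [temper_rightTemperedDeriv] at hg
  have e1 : nu + i = (nu + 1 + i) - 1 := by ring
  have e2 : nu + s + i = (nu + 1 + i) + s - 1 := by ring
  have e3 : nu + s + 1 + i = nu + 1 + i + s := by ring
  rw [integral_congr_ae (g := fun x : ℝ =>
    ((x ^ (nu + s + i) : ℝ) : ℂ) * rightRLDeriv s (temper lam v) x)
    (h1.mono fun x hx => by simp only [hx])]
  rw [e1] at hf
  rw [e2] at hg
  have key := hv.1.isRightRLDeriv.moment hs (by linarith : 1 < nu + 1 + i) hf hg
  rw [e2, e1, laguerreCoeff, laguerreCoeff, e3]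
  simp only [div_eq_mul_inv, Complex.ofReal_mul, Complex.ofReal_inv, mul_assoc]
  rw [key]

/-- By convexity of $\log\Gamma$, its slope on $[y,y+t]$ is at least its slope on $[y-1,y]$, which
is $\log(y-1)\ge\log N$. -/
theorem Gamma_mul_rpow_le {y t N : ℝ} (hN : 0 < N) (hy : N ≤ y - 1) (ht : 0 ≤ t) :
    Real.Gamma y * N ^ t ≤ Real.Gamma (y + t) := by
  rcases ht.eq_or_lt with rfl | ht
  · simp
  have hy0 : 0 < y - 1 := hN.trans_le hy
  have p0 := Real.Gamma_pos_of_pos hy0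
  have p1 := Real.Gamma_pos_of_pos (by linarith : 0 < y)
  have p2 := Real.Gamma_pos_of_pos (by linarith : 0 < y + t)
  have h := Real.convexOn_log_Gamma.slope_mono_adjacent (x := y - 1) (y := y) (z := y + t)
    hy0 (by simp only [mem_Ioi]; linarith) (by linarith) (by linarith)
  have e : Real.Gamma y = (y - 1) * Real.Gamma (y - 1) := by
    rw [← Real.Gamma_add_one hy0.ne']
    ring_nf
  have e1 : Real.log (Real.Gamma y) = Real.log (y - 1) + Real.log (Real.Gamma (y - 1)) := by
    rw [e, Real.log_mul hy0.ne' p0.ne']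
  simp only [Function.comp_apply, sub_sub_cancel, div_one, add_sub_cancel_left] at h
  rw [le_div_iff₀ ht] at h
  have hlog := Real.log_le_log hN hy
  rw [← Real.log_le_log_iff (by positivity) p2, Real.log_mul p1.ne' (by positivity),
    Real.log_rpow hN]
  nlinarith

theorem laguerreWeight_le {nu lam s r : ℝ} {N n : ℕ} (hnu : 0 < nu) (hl : 0 < lam) (hs : 0 ≤ s)
    (hsr : s ≤ r) (hN : 0 < N) (hn : N ≤ n) :
    laguerreWeight (nu + s) lam n ≤
      (2 * lam * N) ^ (s - r) * laguerreWeight (nu + r) lam n := by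
  have hN' : (0 : ℝ) < N := by exact_mod_cast hN
  have hn' : (N : ℝ) ≤ n := by exact_mod_cast hn
  have h := Gamma_mul_rpow_le (y := nu + s + 1 + n) (t := r - s) hN' (by linarith) (by linarith)
  have e1 : nu + s + 1 + n + (r - s) = nu + r + 1 + n := by ring
  have e2 : (2 * lam) ^ (nu + s + 1) = (2 * lam) ^ (s - r) * (2 * lam) ^ (nu + r + 1) := by
    rw [← Real.rpow_add (by positivity)]
    ring_nf
  have e3 : (N : ℝ) ^ (s - r) * N ^ (r - s) = 1 := by
    rw [← Real.rpow_add hN']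
    simp
  rw [e1] at h
  rw [laguerreWeight, laguerreWeight, Real.mul_rpow (by positivity) hN'.le, e2, ← mul_div_assoc]
  refine div_le_div_of_nonneg_right ?_ (by positivity)
  calc _ = (2 * lam) ^ (s - r) * N ^ (s - r) * ((2 * lam) ^ (nu + r + 1) *
        (Real.Gamma (nu + s + 1 + n) * N ^ (r - s))) := by
        linear_combination (-(2 * lam) ^ (s - r) * (2 * lam) ^ (nu + r + 1) *
          Real.Gamma (nu + s + 1 + n)) * e3
    _ ≤ _ := by gcongr

/-- The derivative of $v$ is explicit, again $e^{-\lambda x}$ times a polynomial, hence square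
integrable; that of $u$ is given. -/
theorem TemperedDerivMemL2.sub_of_mem_expPolySpace {nu lam s : ℝ} {N : ℕ} (hl : 0 < lam)
    (ha : -1 < nu + s) {u v : Lp ℂ 2 (weightMeasure nu)}
    (hu : TemperedDerivMemL2 lam s (nu + s) u) (hv : v ∈ expPolySpace nu lam N) :
    TemperedDerivMemL2 lam s (nu + s) (v - u : Lp ℂ 2 (weightMeasure nu)) := by
  obtain ⟨p, -, hp⟩ := hv
  -- The rate is $2\lambda$: one factor $e^{-\lambda x}$ belongs to $v$, the other to the tempering.
  obtain ⟨q, hq⟩ := exists_isRightRLDeriv_temper_eval (s := s) (by positivity : 0 < 2 * lam) p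
  have htt : ∀ (q : Polynomial ℂ) (x : ℝ), temper (2 * lam) (fun x => q.eval (x : ℂ)) x =
      temper lam (temper lam fun x => q.eval (x : ℂ)) x := by
    intro q x
    have : Real.exp (-(2 * lam * x)) = Real.exp (-(lam * x)) * Real.exp (-(lam * x)) := by
      rw [← Real.exp_add]; ring_nf
    simp only [temper, this]
    push_cast
    ring
  have hd := (hq.sub hu.1.isRightRLDeriv).congr
    (f' := temper lam (v - u : Lp ℂ 2 (weightMeasure nu))) ?_ EventuallyEq.rfl
  · have hw : HasRightTemperedDeriv lam s (v - u : Lp ℂ 2 (weightMeasure nu)) := ⟨_, hd⟩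
    refine ⟨hw, ((memLp_temper_eval ha hl q).sub hu.2).ae_eq ?_⟩
    have h1 := hd.unique hw.isRightRLDeriv
    rw [EventuallyEq, ← ae_weightMeasure (nu + s)] at h1
    filter_upwards [h1] with x hx
    rw [rightTemperedDeriv, ← hx, htt, temper, mul_sub, ← mul_assoc, ← Complex.ofReal_mul,
      ← Real.exp_add]
    simp [rightTemperedDeriv]
  · rw [EventuallyEq, ← ae_weightMeasure nu]
    filter_upwards [hp, Lp.coeFn_sub v u] with x h1 h2
    rw [htt]
    simp only [temper] at h1 ⊢
    rw [h2, Pi.sub_apply, h1, mul_sub]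

theorem inner_laguerrePoly_laguerreProj_sub {nu lam : ℝ} (hnu : -1 < nu) (hl : 0 < lam) (N : ℕ)
    (u : Lp ℂ 2 (weightMeasure nu)) (n : ℕ) :
    inner ℂ (temperLp hnu hl (laguerrePoly nu lam n)) (laguerreProj nu lam N u - u) =
      if n ≤ N then 0 else -inner ℂ (temperLp hnu hl (laguerrePoly nu lam n)) u := by
  split_ifs with h
  · have hmem : temperLp hnu hl (laguerrePoly nu lam n) ∈ expPolySpace nu lam N := by
      refine ⟨_, ?_, coeFn_temperLp hnu hl _⟩
      exact Polynomial.degree_le_of_natDegree_le ((laguerrePoly_natDegree_le nu lam n).trans h)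
    have h1 := Submodule.inner_right_of_mem_orthogonal hmem
      (Submodule.sub_starProjection_mem_orthogonal (K := expPolySpace nu lam N) u)
    rw [← neg_sub, inner_neg_right, neg_eq_zero]
    exact h1
  · obtain ⟨p, hp, hpe⟩ : laguerreProj nu lam N u ∈ expPolySpace nu lam N :=
      Submodule.starProjection_apply_mem _ u
    have h1 : laguerreProj nu lam N u = temperLp hnu hl p :=
      Lp.ext (hpe.trans (coeFn_temperLp hnu hl p).symm)
    have hp' : p.natDegree ≤ N := Polynomial.natDegree_le_of_degree_le hp
    rw [inner_sub_right, h1, inner_laguerrePoly_temperLp hnu hl (by lia),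
      Polynomial.coeff_eq_zero_of_natDegree_lt (by lia), zero_mul, zero_sub]

theorem mainTheorem4 (nu r : ℝ) (hnu : 0 < nu) (hr : 0 < r) :
    ∃ c : ℕ → ℝ, Tendsto c atTop (𝓝 1) ∧
      ∀ (lam s : ℝ) (N : ℕ), 0 < lam → 0 ≤ s → s ≤ r → r ≤ N →
        ∀ u ∈ spaceB nu lam r,
          TemperedDerivMemL2 lam s (nu + s) (laguerreProj nu lam N u - u : Lp ℂ 2 (weightMeasure nu)) ∧
          weightNorm (nu + s)
              (rightTemperedDeriv lam s (laguerreProj nu lam N u - u : Lp ℂ 2 (weightMeasure nu))) ≤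
            c N * (2 * lam * N) ^ ((s - r) / 2) *
              weightNorm (nu + r) (rightTemperedDeriv lam r u) := by
  -- The comparison of weights loses no constant, so $c_N=1$ for every $N$.
  refine ⟨fun _ => 1, tendsto_const_nhds, fun lam s N hl hs hsr hrN u hu => ?_⟩
  have hN : (0 : ℝ) < N := hr.trans_le hrN
  have hw : TemperedDerivMemL2 lam s (nu + s)
      (laguerreProj nu lam N u - u : Lp ℂ 2 (weightMeasure nu)) :=
    (hu s hs hsr).sub_of_mem_expPolySpace hl (by linarith) (Submodule.starProjection_apply_mem _ u)
  have hur := hu r hr.le le_rfl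
  refine ⟨hw, ?_⟩
  rw [weightNorm_eq_norm_toLp hw.2, weightNorm_eq_norm_toLp hur.2, one_mul]
  have h1 := hasSum_laguerreWeight_mul_norm_sq (by linarith : -1 < nu + s) hl
    (hw.2.toLp (rightTemperedDeriv lam s _))
  have h2 := (hasSum_laguerreWeight_mul_norm_sq (by linarith : -1 < nu + r) hl
    (hur.2.toLp (rightTemperedDeriv lam r _))).mul_left ((2 * lam * N) ^ (s - r))
  -- Both squared norms are series in the same coefficients $|c_n(u)|^2$, apart from the terms $n\le
  -- N$ missing on the left, and are compared term by term.
  have h3 := hasSum_le (fun n => ?_) h1 h2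
  · refine (pow_le_pow_iff_left₀ (norm_nonneg _) (by positivity) two_ne_zero).1 ?_
    rw [mul_pow, ← Real.rpow_natCast ((2 * lam * N) ^ ((s - r) / 2)), ← Real.rpow_mul (by positivity)]
    convert h3 using 3
    simp
  · rw [inner_laguerrePoly_rightTemperedDeriv hnu hl hs hw,
      inner_laguerrePoly_rightTemperedDeriv hnu hl hr.le hur,
      inner_laguerrePoly_laguerreProj_sub]
    have p := laguerreWeight_pos (by linarith : -1 < nu + r) hl n
    split_ifs with hn
    · rw [norm_zero]
      simp only [ne_eq, OfNat.ofNat_ne_zero, not_false_eq_true, zero_pow, mul_zero]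
      positivity
    · rw [norm_neg, ← mul_assoc]
      gcongr
      exact laguerreWeight_le hnu hl hs hsr (by exact_mod_cast hN) (by lia)
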